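/- Let $\mathbb K\in\{\mathbb R,\mathbb C\}$, let $(\rho,V)$ be a continuous finite-dimensional representation of $SO(2)$ and $(\rho^{\uparrow},V^{\uparrow})$ a continuous finite-dimensional representation of $SO(3)$ over $\mathbb K$. View $SO(2)\subset SO(3)$ as the rotations about the $z$-axis and $SE(2)=\mathbb R^2\rtimes SO(2)\subset SE(3)=\mathbb R^3\rtimes SO(3)$ as the motions of the $(x,y)$-plane; write $h_c$ for the rotation part of $h$. $SE(2)$ acts on fields $f:\mathbb R^2\to V$ by $(\pi(h)f)(r)=\rho(h_c)f(h^{-1}r)$, and $SE(3)$ acts on fields $f^{\uparrow}:\mathbb R^3\times S^2\to V^{\uparrow}$ by $(\pi^{\uparrow}(g)f^{\uparrow})(p,\hat n)=\rho^{\uparrow}(g_c)f^{\uparrow}(g^{-1}p,g_c^{-1}\hat n)$. For each $\ell\ge 0$ let $(Y_\ell^k)_{-\ell\le k\le \ell}$ be an orthonormal basis of the spherical harmonics of degree $\ell$ in $L^2(S^2)$, let $Y_\ell(\hat n)=(Y^k_\ell(\hat n))_k\in W^\ell=\mathbb K^{2\ell+1}$, and let $D^\ell$ be the representation of $SO(3)$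 on $W^\ell$ with $Y_\ell(g\hat n)=D^\ell(g)Y_\ell(\hat n)$. For $F\in\mathrm{Hom}(V\otimes W^\ell,V^{\uparrow})$ and $w\in W^\ell$ let $F\cdot w\in \mathrm{Hom}(V,V^{\uparrow})$ be $v\mapsto F(v\otimes w)$. Let $\mathcal F$ be any $SE(2)$-stable linear space of measurable fields $\mathbb R^2\to V$ that contains the continuous fields of compact support. A linear map $\Phi$ from $\mathcal F$ to the fields $\mathbb R^3\times S^2\to V^{\uparrow}$ is called an integral map if $\Phi(f)(p,\hat n)=\int_{\mathbb R^2}\kappa(p,\hat n:r)f(r)\,dr$ for all $f\in\mathcal F$, $p$, $\hat n$, with a kernel $\kappa(p,\hat n:r)\in\mathrm{Hom}(V,V^{\uparrow})$ that is measurable in $(\hat n,r)$ for each $p$, such that all these integrals converge absolutely and $\int_{\mathbb R^2}\|\kappa(p,\cdot:r)\|_{L^2(S^2)}|f(r)|\,dr<\infty$ for all $p$ and $f\in\mathcal F$. 1. If $\mathcal F=L^2(\mathbb R^2;V)$ (square-integrable functions), then every linear map $\Phi$ from $\mathcal F$ to fields such that $\Phi(f)(p,\cdot)$ is measurable for all $f,p$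 and, for each $p$, $\sup_{\hat n}|\Phi(f)(p,\hat n)|\le C_p\|f\|_{L^2}$ for all $f$, is an integral map. 2. Let $\Phi$ be an integral map on a space $\mathcal F$ as above. Then $\Phi$ is $SE(2)$-equivariant, i.e. $\Phi(\pi(h)f)=\pi^{\uparrow}(h)\Phi(f)$ for all $h\in SE(2)$ and $f\in\mathcal F$, if and only if there are, for each $z\in\mathbb R$, a measurable kernel $\kappa_z:S^2\times\mathbb R^2\to\mathrm{Hom}(V,V^{\uparrow})$ and measurable functions $F_{\ell,z}:\mathbb R^2\to\mathrm{Hom}(V\otimes W^\ell,V^{\uparrow})$, $\ell\ge0$, such that (a) $\Phi(f)(x,y,z,\hat n)=\int_{\mathbb R^2}\kappa_z(\hat n,(x,y)-r)f(r)\,dr$ for all $f\in\mathcal F$, $x,y,z,\hat n$, with absolutely convergent integrals; (b) $\kappa_z(h\hat n,hr)=\rho^{\uparrow}(h)\kappa_z(\hat n,r)\rho(h^{-1})$ for all $h\in SO(2)$, $\hat n$, $r$, $z$; (c) $\kappa_z(\cdot,r)=\sum_{\ell=0}^\infty F_{\ell,z}(r)\cdot Y_\ell(\cdot)$ in $L^2(S^2;\mathrm{Hom}(V,V^{\uparrow}))$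 for all $z$ and $r$; (d) for each fixed $z$ and $\ell$, $F_{\ell,z}$ is an $SO(2)$-steerable kernel with input representation $\rho^\ell=\rho\otimes\mathrm{Res}^{SO(3)}_{SO(2)}D^\ell$ and output representation $\mathrm{Res}^{SO(3)}_{SO(2)}\rho^{\uparrow}$: $F_{\ell,z}(hr)=\rho^{\uparrow}(h)F_{\ell,z}(r)\rho^\ell(h^{-1})$ for all $h\in SO(2)$, $r\in\mathbb R^2$; (e) $\Phi(f)(x,y,z,\cdot)=\sum_{\ell=0}^\infty (F_{\ell,z}\star f)(x,y)\cdot Y_\ell(\cdot)=\sum_{\ell=0}^\infty\int_{\mathbb R^2}F_{\ell,z}((x,y)-r)\bigl(f(r)\otimes Y_\ell(\cdot)\bigr)dr$ in $L^2(S^2;V^{\uparrow})$ for all $f\in\mathcal F$, $x,y,z$, with absolutely convergent convolutions. 3. Conversely, if $\Phi$ is any linear map from a space $\mathcal F$ as above to fields for which (e) holds with functions $F_{\ell,z}$ satisfying (d), then for all $h\in SE(2)$, $f\in\mathcal F$ and $p\in\mathbb R^3$ one has $\Phi(\pi(h)f)(p,\hat n)=(\pi^{\uparrow}(h)\Phi(f))(p,\hat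 n)$ for almost every $\hat n\in S^2$. -/

import Mathlib

open MeasureTheory Filter Topology
open scoped TensorProduct ENNReal ComplexConjugate

noncomputable section

namespace PoseKernel

/-! ### Euclidean spaces, rotations, rigid motions -/

/-- Euclidean space `ℝⁿ`. -/
abbrev E (n : ℕ) : Type := EuclideanSpace ℝ (Fin n)

/-- The unit sphere `S²` in `ℝ³`. -/
abbrev S2 : Type := Metric.sphere (0 : E 3) 1

/-- The surface measure on `S²` (total mass `4π`). -/
abbrev sphereMeasure : Measure S2 := (volume : Measure (E 3)).toSphere

/-- The rotation group `SO(n)`. -/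
abbrev SO (n : ℕ) : Type := Matrix.specialOrthogonalGroup (Fin n) ℝ

theorem transpose_mul_self {n : ℕ} (g : SO n) : (g : Matrix (Fin n) (Fin n) ℝ).transpose * g = 1 :=
  Matrix.UnitaryGroup.star_mul_self (α := ℝ) ⟨g.1, (Matrix.mem_specialOrthogonalGroup_iff.1 g.2).1⟩

theorem norm_mulVec {n : ℕ} (g : SO n) (v : E n) :
    ‖(WithLp.toLp 2 ((g : Matrix (Fin n) (Fin n) ℝ).mulVec v.ofLp) : E n)‖ = ‖v‖ := by
  have h : ∀ w : E n, ‖w‖ ^ 2 = w.ofLp ⬝ᵥ w.ofLp := fun w => by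
    rw [EuclideanSpace.norm_sq_eq]
    simp [dotProduct, sq]
  rw [← sq_eq_sq₀ (norm_nonneg _) (norm_nonneg _), h, h]
  simp only [Matrix.dotProduct_mulVec, Matrix.vecMul_mulVec, transpose_mul_self]
  simp

/-- The standard action of `SO(n)` on `ℝⁿ` by matrix multiplication. -/
def rot {n : ℕ} : SO n →* (E n ≃ₗᵢ[ℝ] E n) where
  toFun g :=
    { toFun := fun v => WithLp.toLp 2 ((g : Matrix (Fin n) (Fin n) ℝ).mulVec v.ofLp)
      map_add' := fun v w => by simp [Matrix.mulVec_add]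
      map_smul' := fun c v => by simp [Matrix.mulVec_smul]
      invFun := fun v => WithLp.toLp 2 (((g⁻¹ : SO n) : Matrix (Fin n) (Fin n) ℝ).mulVec v.ofLp)
      left_inv := fun v => by
        change WithLp.toLp 2 (Matrix.mulVec _ (Matrix.mulVec _ v.ofLp)) = v
        rw [Matrix.mulVec_mulVec, ← Submonoid.coe_mul, inv_mul_cancel]; simp
      right_inv := fun v => by
        change WithLp.toLp 2 (Matrix.mulVec _ (Matrix.mulVec _ v.ofLp)) = v
        rw [Matrix.mulVec_mulVec, ← Submonoid.coe_mul, mul_inv_cancel]; simp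
      norm_map' := fun v => norm_mulVec g v }
  map_one' := by ext v; simp
  map_mul' g h := by ext v; simp [Matrix.mulVec_mulVec]

/-- The action of `SO(3)` on the sphere. -/
def rotSphere (g : SO 3) (n : S2) : S2 :=
  ⟨rot g n.1, by
    have h : ‖n.1‖ = 1 := mem_sphere_zero_iff_norm.1 n.2
    simp [h]⟩

theorem rotSphere_one (n : S2) : rotSphere 1 n = n := by
  apply Subtype.ext; simp [rotSphere]

theorem rotSphere_mul (g h : SO 3) (n : S2) :
    rotSphere (g * h) n = rotSphere g (rotSphere h n) := by
  apply Subtype.ext; simp [rotSphere]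

/-- The action of `SO(n)` on the translation group `ℝⁿ`. -/
def translationAut (n : ℕ) : SO n →* MulAut (Multiplicative (E n)) where
  toFun g := AddEquiv.toMultiplicative (rot g).toLinearEquiv.toAddEquiv
  map_one' := by ext v; simp
  map_mul' g h := by ext v; simp

/-- The group `SE(n) = ℝⁿ ⋊ SO(n)`; every element is `h = h̄ h_c` with the translation
`h̄ = h.left` and the rotation `h_c = h.right`. -/
abbrev SE (n : ℕ) : Type := Multiplicative (E n) ⋊[translationAut n] SO n

/-- The action `h · r = h_c r + h̄` of `SE(n)` on `ℝⁿ`. -/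
def rigid {n : ℕ} (h : SE n) (r : E n) : E n := rot h.right r + h.left.toAdd

theorem rigid_one {n : ℕ} (r : E n) : rigid 1 r = r := by simp [rigid]

theorem rigid_mul {n : ℕ} (g h : SE n) (r : E n) : rigid (g * h) r = rigid g (rigid h r) := by
  simp [rigid, translationAut]
  abel

/-- The inclusion `SO(2) ⊆ SO(3)` as the in-plane rotations, i.e. the rotations about the
`z`-axis. -/
def inclSO : SO 2 →* SO 3 where
  toFun g := ⟨!![g.1 0 0, g.1 0 1, 0; g.1 1 0, g.1 1 1, 0; 0, 0, 1], by
    obtain ⟨h1, h2, h3⟩ := Matrix.mem_specialOrthogonalGroup_fin_two_iff.1 g.2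
    rw [Matrix.mem_specialOrthogonalGroup_iff, Matrix.mem_orthogonalGroup_iff]
    refine ⟨?_, ?_⟩
    · ext i j
      fin_cases i <;> fin_cases j <;>
        simp [Matrix.mul_apply, Fin.sum_univ_three] <;> grind
    · simp [Matrix.det_fin_three]; grind⟩
  map_one' := by
    apply Subtype.ext
    ext i j
    fin_cases i <;> fin_cases j <;> simp
  map_mul' g h := by
    apply Subtype.ext
    ext i j
    fin_cases i <;> fin_cases j <;> simp [Matrix.mul_apply, Fin.sum_univ_two]

/-- The point `(x, y, z)` of `ℝ³` over the image point `(x, y)`, at depth `z`. -/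
def point (r : E 2) (z : ℝ) : E 3 := !₂[r 0, r 1, z]

theorem rot_inclSO (g : SO 2) (r : E 2) (z : ℝ) :
    rot (inclSO g) (point r z) = point (rot g r) z := by
  ext i
  fin_cases i <;>
    simp [rot, inclSO, point, dotProduct, Fin.sum_univ_three]

/-- The translations of the image plane as translations of `ℝ³`. -/
def inclTranslation : Multiplicative (E 2) →* Multiplicative (E 3) :=
  AddMonoidHom.toMultiplicative
    { toFun := fun r => point r 0
      map_zero' := by ext i; fin_cases i <;> simp [point]
      map_add' := fun r s => by ext i; fin_cases i <;> simp [point] }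

/-- The inclusion `SE(2) ⊆ SE(3)`: rigid motions of the image plane. -/
def inclSE : SE 2 →* SE 3 :=
  SemidirectProduct.map inclTranslation inclSO (fun g => by
    refine MonoidHom.ext fun r => ?_
    exact congrArg Multiplicative.ofAdd (rot_inclSO g r.toAdd 0).symm)

theorem rigid_inclSE (h : SE 2) (r : E 2) (z : ℝ) :
    rigid (inclSE h) (point r z) = point (rigid h r) z := by
  have h1 : rigid (inclSE h) (point r z)
      = rot (inclSO h.right) (point r z) + point h.left.toAdd 0 := rfl
  rw [h1, rot_inclSO]
  ext i
  fin_cases i <;> simp [rigid, point]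

/-! ### Field representations -/

section Fields

variable {𝕜 : Type*} [RCLike 𝕜]
variable {V : Type*} [NormedAddCommGroup V] [NormedSpace 𝕜 V]
variable {V' : Type*} [NormedAddCommGroup V'] [NormedSpace 𝕜 V']

/-- The representation `π` of `SE(2)` on planar fields: `(π(h) f)(r) = ρ(h_c) f(h⁻¹ r)`. -/
def planarRep (ρ : Representation 𝕜 (SO 2) V) : Representation 𝕜 (SE 2) (E 2 → V) where
  toFun h :=
    { toFun := fun f r => ρ h.right (f (rigid h⁻¹ r))
      map_add' := fun f g => by ext r; simp
      map_smul' := fun c f => by ext r; simp }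
  map_one' := by ext f r; simp [rigid_one]
  map_mul' g h := by ext f r; simp [rigid_mul]

/-- The representation `π↑` of `SE(3)` on fields over `ℝ³ × S²`:
`(π↑(g) f)(p, n) = ρ↑(g_c) f(g⁻¹ p, g_c⁻¹ n)`. -/
def poseRep (ρ' : Representation 𝕜 (SO 3) V') : Representation 𝕜 (SE 3) (E 3 × S2 → V') where
  toFun g :=
    { toFun := fun f q => ρ' g.right (f (rigid g⁻¹ q.1, rotSphere g.right⁻¹ q.2))
      map_add' := fun f f' => by ext q; simp
      map_smul' := fun c f => by ext q; simp }
  map_one' := by ext f q; simp [rigid_one, rotSphere_one]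
  map_mul' g h := by ext f q; simp [rigid_mul, rotSphere_mul]

/-- A representation is continuous (strongly; for finite-dimensional spaces this is continuity of
its matrix entries). -/
def IsContinuousRep {G : Type*} [Group G] [TopologicalSpace G] (ρ : Representation 𝕜 G V) : Prop :=
  ∀ v : V, Continuous fun g => ρ g v

/-- A space `𝓕` of planar `V`-valued signals on which integral transforms make sense: a linear
space of measurable fields, stable under `SE(2)`, that contains the continuous fields of compact
support. -/
structure IsSignalSpace (ρ : Representation 𝕜 (SO 2) V) (𝓕 : Submodule 𝕜 (E 2 → V)) : Prop where
  measurable : ∀ f ∈ 𝓕, AEStronglyMeasurable f volume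
  stable : ∀ h : SE 2, 𝓕 ≤ 𝓕.comap (planarRep ρ h)
  testFields : ∀ f : E 2 → V, Continuous f → HasCompactSupport f → f ∈ 𝓕

/-- The space of square-integrable planar fields. -/
def squareIntegrableFields (𝕜 V : Type*) [RCLike 𝕜] [NormedAddCommGroup V] [NormedSpace 𝕜 V] :
    Submodule 𝕜 (E 2 → V) where
  carrier := {f | MemLp f 2 volume}
  add_mem' hf hg := hf.add hg
  zero_mem' := MemLp.zero
  smul_mem' c _ hf := hf.const_smul c

/-- `Φ` intertwines `π` and the restriction of `π↑` to `SE(2)`. -/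
def IsEquivariant (ρ : Representation 𝕜 (SO 2) V) (ρ' : Representation 𝕜 (SO 3) V')
    {𝓕 : Submodule 𝕜 (E 2 → V)} (h𝓕 : IsSignalSpace ρ 𝓕) (Φ : 𝓕 →ₗ[𝕜] (E 3 × S2 → V')) : Prop :=
  ∀ (h : SE 2) (f : 𝓕),
    Φ ((planarRep ρ).subrepresentation 𝓕 h𝓕.stable h f) = ((poseRep ρ').comp inclSE) h (Φ f)

variable [NormedSpace ℝ V']

/-- `Φ` is an integral transform `Φ(f)(p, n) = ∫ κ(p, n : r) f(r) dr` whose kernel is measurable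
in `(n, r)`, square-integrable over the sphere in `n`, and such that all integrals converge. -/
def IsIntegralMap {𝓕 : Submodule 𝕜 (E 2 → V)} (Φ : 𝓕 →ₗ[𝕜] (E 3 × S2 → V')) : Prop :=
  ∃ κ : E 3 × S2 → E 2 → (V →L[𝕜] V'),
    (∀ p : E 3, StronglyMeasurable fun q : S2 × E 2 => κ (p, q.1) q.2) ∧
    (∀ (p : E 3), ∀ f ∈ 𝓕,
      ∫⁻ r, eLpNorm (fun n : S2 => κ (p, n) r) 2 sphereMeasure * ‖f r‖ₑ < ∞) ∧
    ∀ (f : 𝓕) (p : E 3) (n : S2),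
      Integrable (fun r => κ (p, n) r (f.1 r)) ∧ Φ f (p, n) = ∫ r, κ (p, n) r (f.1 r)

/-- `Φ` is, for each depth `z` and each direction `n`, the planar convolution with the kernel
`κ_z(n, ·)`: `Φ(f)(x, y, z, n) = ∫ κ_z(n, (x, y) - r) f(r) dr`. -/
def IsPlanarConvolution {𝓕 : Submodule 𝕜 (E 2 → V)} (Φ : 𝓕 →ₗ[𝕜] (E 3 × S2 → V'))
    (κ : ℝ → S2 → E 2 → (V →L[𝕜] V')) : Prop :=
  ∀ (f : 𝓕) (x : E 2) (z : ℝ) (n : S2),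
    Integrable (fun r => κ z n (x - r) (f.1 r)) ∧
      Φ f (point x z, n) = ∫ r, κ z n (x - r) (f.1 r)

end Fields

/-! ### Spherical harmonics -/

section Harmonics

variable (𝕜 : Type*) [RCLike 𝕜]

/-- Homogeneous harmonic polynomials of degree `ℓ` in three variables. -/
def harmonicPolynomials (ℓ : ℕ) : Submodule 𝕜 (MvPolynomial (Fin 3) 𝕜) where
  carrier := {P | P.IsHomogeneous ℓ ∧ ∑ i, MvPolynomial.pderiv i (MvPolynomial.pderiv i P) = 0}
  add_mem' hP hQ := ⟨hP.1.add hQ.1, by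
    have h1 := hP.2
    have h2 := hQ.2
    simp only [map_add, Finset.sum_add_distrib, h1, h2, add_zero]⟩
  zero_mem' := ⟨MvPolynomial.isHomogeneous_zero _ _ _, by simp⟩
  smul_mem' c P hP := ⟨(MvPolynomial.homogeneousSubmodule (Fin 3) 𝕜 ℓ).smul_mem c hP.1, by
    have h := hP.2
    simp only [Derivation.map_smul, ← Finset.smul_sum, h, smul_zero]⟩

/-- Restriction of polynomials to the sphere. -/
def restrictSphere : MvPolynomial (Fin 3) 𝕜 →ₗ[𝕜] (S2 → 𝕜) where
  toFun P n := MvPolynomial.eval (fun i => ((n.1 i : ℝ) : 𝕜)) P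
  map_add' P Q := by ext n; simp
  map_smul' c P := by ext n; simp [MvPolynomial.smul_eval]

/-- The space of spherical harmonics of degree `ℓ`. -/
def sphericalHarmonics (ℓ : ℕ) : Submodule 𝕜 (S2 → 𝕜) :=
  (harmonicPolynomials 𝕜 ℓ).map (restrictSphere 𝕜)

/-- `SO(3)` acts on functions on the sphere by `(g · Y)(n) = Y(g⁻¹ n)`. -/
def sphereFunctionRep : Representation 𝕜 (SO 3) (S2 → 𝕜) where
  toFun g :=
    { toFun := fun Y n => Y (rotSphere g⁻¹ n)
      map_add' := fun Y Z => by ext n; simp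
      map_smul' := fun c Y => by ext n; simp }
  map_one' := by ext Y n; simp [rotSphere_one]
  map_mul' g h := by ext Y n; simp [rotSphere_mul]

variable {𝕜}

/-- Linear substitution `P ↦ P(A x)`. -/
def linSubst (A : Matrix (Fin 3) (Fin 3) ℝ) : MvPolynomial (Fin 3) 𝕜 →ₐ[𝕜] MvPolynomial (Fin 3) 𝕜 :=
  MvPolynomial.aeval fun i => ∑ j, MvPolynomial.C ((A i j : ℝ) : 𝕜) * MvPolynomial.X j

theorem pderiv_linSubst (A : Matrix (Fin 3) (Fin 3) ℝ) (k : Fin 3) (P : MvPolynomial (Fin 3) 𝕜) :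
    MvPolynomial.pderiv k (linSubst A P)
      = ∑ i, MvPolynomial.C ((A i k : ℝ) : 𝕜) * linSubst A (MvPolynomial.pderiv i P) := by
  induction P using MvPolynomial.induction_on with
  | C a => simp [linSubst, MvPolynomial.algebraMap_eq]
  | add P Q hP hQ => simp only [map_add, hP, hQ, mul_add, Finset.sum_add_distrib]
  | mul_X P m hP =>
    have hX : MvPolynomial.pderiv k (linSubst A (MvPolynomial.X m : MvPolynomial (Fin 3) 𝕜))
        = MvPolynomial.C ((A m k : ℝ) : 𝕜) := by
      simp [linSubst, MvPolynomial.pderiv_X, Pi.single_apply]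
    have hd : ∀ i, MvPolynomial.pderiv i (MvPolynomial.X m : MvPolynomial (Fin 3) 𝕜)
        = if i = m then 1 else 0 := by
      intro i
      rw [MvPolynomial.pderiv_X, Pi.single_apply]
      simp [eq_comm]
    simp only [map_mul, Derivation.leibniz, hP, hX, smul_eq_mul, hd, map_add, mul_add,
      Finset.sum_add_distrib]
    simp only [mul_ite, apply_ite (linSubst A), map_one, map_zero, mul_one, mul_zero,
      Finset.sum_ite_eq', Finset.mem_univ, if_true]
    rw [Finset.mul_sum]
    congr 1
    · simp [mul_comm]
    · exact Finset.sum_congr rfl fun i _ => by ring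

theorem linSubst_mem (g : SO 3) {ℓ : ℕ} {P : MvPolynomial (Fin 3) 𝕜}
    (hP : P ∈ harmonicPolynomials 𝕜 ℓ) : linSubst g.1 P ∈ harmonicPolynomials 𝕜 ℓ := by
  refine ⟨?_, ?_⟩
  · have h := MvPolynomial.IsHomogeneous.aeval hP.1
      (fun i => ∑ j, MvPolynomial.C ((g.1 i j : ℝ) : 𝕜) * MvPolynomial.X j) (n := 1) (fun i =>
        MvPolynomial.IsHomogeneous.sum _ _ _ fun j _ => by
          simpa using (MvPolynomial.isHomogeneous_C (Fin 3) ((g.1 i j : ℝ) : 𝕜)).mul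
            (MvPolynomial.isHomogeneous_X 𝕜 j))
    simpa [linSubst] using h
  · have hg : ∀ i j, ∑ k, ((g.1 i k : ℝ) : 𝕜) * ((g.1 j k : ℝ) : 𝕜) = if i = j then 1 else 0 := by
      intro i j
      have h0 : g.1 * (g.1).transpose = 1 := mul_eq_one_comm.1 (transpose_mul_self g)
      have h := congrFun (congrFun h0 i) j
      rw [Matrix.mul_apply] at h
      have h' := congrArg (fun t : ℝ => (t : 𝕜)) h
      simp only [Matrix.transpose_apply, Matrix.one_apply] at h'
      push_cast at h'
      rw [h']
      split_ifs <;> simp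
    simp only [pderiv_linSubst, map_sum, Derivation.leibniz, MvPolynomial.pderiv_C, mul_zero,
      add_zero, smul_eq_mul]
    calc
      _ = ∑ i, ∑ j, MvPolynomial.C (∑ k, ((g.1 i k : ℝ) : 𝕜) * ((g.1 j k : ℝ) : 𝕜)) *
            linSubst g.1 (MvPolynomial.pderiv j (MvPolynomial.pderiv i P)) := by
          rw [Finset.sum_comm]
          refine Finset.sum_congr rfl fun i _ => ?_
          simp only [Finset.mul_sum, map_sum, Finset.sum_mul]
          rw [Finset.sum_comm]
          refine Finset.sum_congr rfl fun j _ => Finset.sum_congr rfl fun k _ => ?_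
          rw [map_mul]
          ring
      _ = linSubst g.1 (∑ i, MvPolynomial.pderiv i (MvPolynomial.pderiv i P)) := by
          simp [hg, apply_ite MvPolynomial.C, ite_mul]
      _ = 0 := by rw [hP.2, map_zero]

theorem sphericalHarmonics_stable (ℓ : ℕ) (g : SO 3) :
    sphericalHarmonics 𝕜 ℓ ≤ (sphericalHarmonics 𝕜 ℓ).comap (sphereFunctionRep 𝕜 g) := by
  rintro _ ⟨P, hP, rfl⟩
  refine ⟨linSubst (g⁻¹ : SO 3).1 P, linSubst_mem g⁻¹ hP, ?_⟩
  ext n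
  simp only [restrictSphere, sphereFunctionRep, linSubst, LinearMap.coe_mk, AddHom.coe_mk,
    MonoidHom.coe_mk, OneHom.coe_mk]
  rw [MvPolynomial.aeval_def, MvPolynomial.eval_eval₂]
  have hC : (MvPolynomial.eval fun i => ((n.1 i : ℝ) : 𝕜)).comp
      (algebraMap 𝕜 (MvPolynomial (Fin 3) 𝕜)) = RingHom.id 𝕜 := by
    ext a; simp [MvPolynomial.algebraMap_eq]
  rw [hC]
  change MvPolynomial.eval _ P = _
  congr 2
  ext i
  simp [rotSphere, rot, Matrix.mulVec, dotProduct]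

/-- The representation of `SO(3)` on the spherical harmonics of degree `ℓ`. -/
def harmonicRep (𝕜 : Type*) [RCLike 𝕜] (ℓ : ℕ) :
    Representation 𝕜 (SO 3) (sphericalHarmonics 𝕜 ℓ) :=
  (sphereFunctionRep 𝕜).subrepresentation _ (sphericalHarmonics_stable ℓ)

/-- The space `W^ℓ`, with coordinates indexed by the `2ℓ + 1` orders `-ℓ ≤ k ≤ ℓ` (shifted to
`0, …, 2ℓ`). -/
abbrev W (𝕜 : Type*) (ℓ : ℕ) : Type _ := Fin (2 * ℓ + 1) → 𝕜

/-- A basis of the spherical harmonics of degree `ℓ`, consisting of functions `Y_ℓ^k`. -/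
abbrev HarmonicBasis (𝕜 : Type*) [RCLike 𝕜] (ℓ : ℕ) : Type _ :=
  Module.Basis (Fin (2 * ℓ + 1)) 𝕜 (sphericalHarmonics 𝕜 ℓ)

/-- The vector `Y_ℓ(n) = (Y_ℓ^k(n))_k` in `W^ℓ`. -/
def harmonicVector {ℓ : ℕ} (Y : HarmonicBasis 𝕜 ℓ) (n : S2) : W 𝕜 ℓ := fun k => (Y k).1 n

/-- Orthonormality of the `Y_ℓ^k` in `L²(S²)`. -/
def IsOrthonormalBasis {ℓ : ℕ} (Y : HarmonicBasis 𝕜 ℓ) : Prop :=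
  ∀ k k', ∫ n, conj ((Y k).1 n) * (Y k').1 n ∂sphereMeasure = if k = k' then 1 else 0

/-- The representation `D^ℓ` of `SO(3)` on `W^ℓ` by the Wigner matrices of the basis `Y_ℓ^k`; it is
determined by `Y_ℓ(g n) = D^ℓ(g) Y_ℓ(n)`, see `harmonicVector_rotSphere`. -/
def wignerD {ℓ : ℕ} (Y : HarmonicBasis 𝕜 ℓ) : Representation 𝕜 (SO 3) (W 𝕜 ℓ) where
  toFun g := Matrix.toLin' (LinearMap.toMatrix Y Y (harmonicRep 𝕜 ℓ g⁻¹)).transpose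
  map_one' := by simp [Module.End.one_eq_id]
  map_mul' g h := by
    rw [mul_inv_rev, map_mul, LinearMap.toMatrix_mul, Matrix.transpose_mul, Matrix.toLin'_mul]
    rfl

theorem harmonicVector_rotSphere {ℓ : ℕ} (Y : HarmonicBasis 𝕜 ℓ) (g : SO 3) (n : S2) :
    harmonicVector Y (rotSphere g n) = wignerD Y g (harmonicVector Y n) := by
  ext k
  have h := congrArg (fun Z : sphericalHarmonics 𝕜 ℓ => Z.1 n)
    (Y.sum_repr (harmonicRep 𝕜 ℓ g⁻¹ (Y k)))
  have h2 : (harmonicRep 𝕜 ℓ g⁻¹ (Y k)).1 n = (Y k).1 (rotSphere g n) := by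
    change (Y k).1 (rotSphere g⁻¹⁻¹ n) = _
    rw [inv_inv]
  simp only [h2] at h
  have h3 : ((∑ i, (Y.repr (harmonicRep 𝕜 ℓ g⁻¹ (Y k))) i • Y i : sphericalHarmonics 𝕜 ℓ)).1 n
      = ∑ i, (Y.repr (harmonicRep 𝕜 ℓ g⁻¹ (Y k))) i * (Y i).1 n := by
    simp only [Submodule.coe_sum, Finset.sum_apply, Submodule.coe_smul, Pi.smul_apply, smul_eq_mul]
  rw [harmonicVector, ← h, h3]
  simp [wignerD, harmonicVector, Matrix.mulVec, dotProduct, LinearMap.toMatrix_apply]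

end Harmonics

/-! ### Steerable kernels and harmonic expansions -/

section Kernels

variable {𝕜 : Type*} [RCLike 𝕜]

/-- `F : ℝ² → Hom(A, B)` is an `SO(2)`-steerable kernel with input representation `σ` and output
representation `τ`: `F(h r) = τ(h) F(r) σ(h⁻¹)`. -/
def IsSteerableKernel {A B : Type*} [AddCommGroup A] [Module 𝕜 A] [AddCommGroup B] [Module 𝕜 B]
    (σ : Representation 𝕜 (SO 2) A) (τ : Representation 𝕜 (SO 2) B)
    (F : E 2 → (A →ₗ[𝕜] B)) : Prop :=
  ∀ (h : SO 2) (r : E 2), F (rot h r) = τ h ∘ₗ F r ∘ₗ σ h⁻¹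

/-- The `L²(S²)`-convergent expansion `g = ∑_ℓ s_ℓ`. -/
def IsL2Series {X : Type*} [NormedAddCommGroup X] (g : S2 → X) (s : ℕ → S2 → X) : Prop :=
  MemLp g 2 sphereMeasure ∧ (∀ ℓ, MemLp (s ℓ) 2 sphereMeasure) ∧
    Tendsto (fun N => eLpNorm (fun n => g n - ∑ ℓ ∈ Finset.range N, s ℓ n) 2 sphereMeasure)
      atTop (𝓝 0)

variable {V : Type*} [NormedAddCommGroup V] [NormedSpace 𝕜 V] [FiniteDimensional 𝕜 V]
variable {V' : Type*} [NormedAddCommGroup V'] [NormedSpace 𝕜 V']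

/-- The contraction `F · w` in `Hom(V, V↑)` of `F` in `Hom(V ⊗ W, V↑)` with a vector `w` of `W`:
`(F · w) v = F (v ⊗ w)`. -/
def contract {ℓ : ℕ} (F : V ⊗[𝕜] W 𝕜 ℓ →ₗ[𝕜] V') (w : W 𝕜 ℓ) : V →L[𝕜] V' :=
  LinearMap.toContinuousLinearMap (F ∘ₗ (TensorProduct.mk 𝕜 V (W 𝕜 ℓ)).flip w)

variable [NormedSpace ℝ V']

/-- The harmonic expansion
`Φ(f)(x, y, z, ·) = ∑_ℓ (F_{ℓ,z} ⋆ f)(x, y) · Y_ℓ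
  = ∑_ℓ ∫ F_{ℓ,z}((x, y) - r) (f(r) ⊗ Y_ℓ(·)) dr`,
in `L²(S²)`, with absolutely convergent planar convolutions. -/
def HasHarmonicExpansion {𝓕 : Submodule 𝕜 (E 2 → V)} (Φ : 𝓕 →ₗ[𝕜] (E 3 × S2 → V'))
    (Y : ∀ ℓ, HarmonicBasis 𝕜 ℓ) (F : ∀ ℓ : ℕ, ℝ → E 2 → (V ⊗[𝕜] W 𝕜 ℓ →ₗ[𝕜] V')) : Prop :=
  ∀ (f : 𝓕) (x : E 2) (z : ℝ),
    (∀ ℓ (w : W 𝕜 ℓ), Integrable fun r => F ℓ z (x - r) (f.1 r ⊗ₜ[𝕜] w)) ∧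
    IsL2Series (fun n => Φ f (point x z, n))
      (fun ℓ n => ∫ r, F ℓ z (x - r) (f.1 r ⊗ₜ[𝕜] harmonicVector (Y ℓ) n))

end Kernels

end PoseKernel

end

/-!
An integral map is determined by kernels `κ(p, n : r)`, and testing against continuous fields of
compact support shows that equivariance under `SE(2)` is covariance of `κ`, up to null sets in `r`
(`ae_covariant_of_isEquivariant`). Translations reduce `κ` to the kernel at `p = (0, 0, z)`, so that
`Φ` is a convolution in the plane, and rotations make that kernel covariant almost everywhere. The
average over `SO(2)` with respect to Haar measure is a version of the kernel that is covariant at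
every point; the set where it is not square-integrable over the sphere is null and
rotation-invariant, and the kernel is set to zero there (`exists_covariant_memLp`).

The kernel is then expanded in spherical harmonics. Their completeness in `L²(S²)`
(`isL2Series_harmonicTerm`) rests on three facts. Every polynomial is a combination of polynomials
`|x|^{2j} H` with `H` harmonic, because the Laplacian acts on these by nonzero constants
(`mem_harmonicSpan`). Harmonics of different degrees are orthogonal, because the squared angular
momentum `∑ L_k²` is symmetric on the sphere and acts on degree `ℓ` by `-ℓ(ℓ+1)`
(`integral_harmonic_mul_harmonic`); symmetry comes from differentiating the rotation invariance of
the surface measure. Polynomials are dense by the Stone-Weierstrass theorem. The coefficients of a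
covariant kernel are steerable because the Wigner matrices are unitary
(`isSteerableKernel_harmonicCoeff`), and the expansion passes under the convolution integral by
Minkowski's inequality and Fubini's theorem (`isL2Series_integral_kernel`).

Conversely a rotation-covariant convolution kernel gives an equivariant map by the substitution
`r ↦ h r`; the same substitution, applied term by term, shows that a harmonic expansion with
steerable coefficients gives both sides of the equivariance identity the same expansion
(`ae_equivariant_of_hasHarmonicExpansion`).

A bounded map on square-integrable fields has, by the Riesz theorem, a square-integrable kernel for
each direction `n`. These kernels are only defined up to null sets, and the limit of their
mollifications is a version that is jointly measurable in `(n, r)` (`exists_jointly_measurable`).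
-/

noncomputable section

namespace PoseKernel

/-! ### Topology and invariant measures for the rotation groups -/

theorem coe_inv_eq_transpose {n : ℕ} (g : SO n) :
    ((g⁻¹ : SO n) : Matrix (Fin n) (Fin n) ℝ) = (g : Matrix (Fin n) (Fin n) ℝ).transpose := by
  have h : (g : Matrix (Fin n) (Fin n) ℝ) * ((g⁻¹ : SO n) : Matrix (Fin n) (Fin n) ℝ) = 1 := by
    rw [← Submonoid.coe_mul, mul_inv_cancel, Submonoid.coe_one]
  exact (left_inv_eq_right_inv (transpose_mul_self g) h).symm

instance {n : ℕ} : IsTopologicalGroup (SO n) where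
  continuous_inv := by
    refine continuous_induced_rng.2 ?_
    have h : (Subtype.val ∘ fun g : SO n => g⁻¹)
        = fun g : SO n => (g : Matrix (Fin n) (Fin n) ℝ).transpose :=
      funext fun g => coe_inv_eq_transpose g
    rw [h]
    exact continuous_subtype_val.matrix_transpose

instance {n : ℕ} : SecondCountableTopology (SO n) :=
  inferInstanceAs (SecondCountableTopology
    {A : Fin n → Fin n → ℝ // A ∈ (Matrix.specialOrthogonalGroup (Fin n) ℝ : Set (Matrix _ _ ℝ))})

theorem isClosed_specialOrthogonalGroup (n : ℕ) :
    IsClosed (Matrix.specialOrthogonalGroup (Fin n) ℝ : Set (Matrix (Fin n) (Fin n) ℝ)) := by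
  have h : (Matrix.specialOrthogonalGroup (Fin n) ℝ : Set (Matrix (Fin n) (Fin n) ℝ))
      = {A | A * A.transpose = 1} ∩ {A | A.det = 1} := by
    ext A
    simp only [SetLike.mem_coe, Matrix.mem_specialOrthogonalGroup_iff,
      Matrix.mem_orthogonalGroup_iff, Set.mem_inter_iff, Set.mem_ofPred_eq]
  rw [h]
  exact (isClosed_eq (by fun_prop) continuous_const).inter
    (isClosed_eq (by fun_prop) continuous_const)

instance {n : ℕ} : CompactSpace (SO n) := by
  refine isCompact_iff_compactSpace.1 (IsCompact.of_isClosed_subset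
    (s := Set.pi Set.univ fun _ : Fin n => Set.pi Set.univ fun _ : Fin n => Set.Icc (-1 : ℝ) 1)
    (isCompact_univ_pi fun _ => isCompact_univ_pi fun _ => isCompact_Icc)
    (isClosed_specialOrthogonalGroup n) fun A hA i _ j _ => ?_)
  have h := entry_norm_bound_of_unitary (𝕜 := ℝ) (Matrix.mem_specialOrthogonalGroup_iff.1 hA).1 i j
  exact abs_le.1 h

theorem continuous_rot {n : ℕ} : Continuous fun p : SO n × E n => rot p.1 p.2 := by
  change Continuous fun p : SO n × E n =>
    (WithLp.toLp 2 ((p.1 : Matrix (Fin n) (Fin n) ℝ).mulVec p.2.ofLp) : E n)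
  fun_prop

theorem continuous_rotSphere : Continuous fun p : SO 3 × S2 => rotSphere p.1 p.2 :=
  continuous_induced_rng.2
    (continuous_rot.comp (continuous_fst.prodMk (continuous_subtype_val.comp continuous_snd)))

theorem continuous_inclSO : Continuous inclSO := by
  refine continuous_induced_rng.2 (continuous_matrix fun i j => ?_)
  have h : ∀ a b, Continuous fun g : SO 2 => g.1 a b := fun a b =>
    (continuous_apply_apply a b).comp continuous_subtype_val
  fin_cases i <;> fin_cases j <;> simp [inclSO] <;> first | exact h _ _ | exact continuous_const

theorem measurePreserving_rot {n : ℕ} (g : SO n) : MeasurePreserving (rot g) volume volume :=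
  (rot g).measurePreserving

theorem rotSphere_inv_rotSphere (g : SO 3) (n : S2) : rotSphere g⁻¹ (rotSphere g n) = n := by
  rw [← rotSphere_mul, inv_mul_cancel, rotSphere_one]

theorem rotSphere_rotSphere_inv (g : SO 3) (n : S2) : rotSphere g (rotSphere g⁻¹ n) = n := by
  rw [← rotSphere_mul, mul_inv_cancel, rotSphere_one]

theorem rot_inv_rot {n : ℕ} (g : SO n) (r : E n) : rot g⁻¹ (rot g r) = r := by
  have h := congrArg (fun φ : E n ≃ₗᵢ[ℝ] E n => φ r) ((rot (n := n)).map_mul g⁻¹ g)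
  simp only [inv_mul_cancel, map_one] at h
  exact h.symm

/-- Rotations of the sphere as measurable equivalences. -/
def rotSphereEquiv (g : SO 3) : S2 ≃ᵐ S2 where
  toFun := rotSphere g
  invFun := rotSphere g⁻¹
  left_inv := rotSphere_inv_rotSphere g
  right_inv := rotSphere_rotSphere_inv g
  measurable_toFun := (continuous_rotSphere.comp (Continuous.prodMk_right g)).measurable
  measurable_invFun := (continuous_rotSphere.comp (Continuous.prodMk_right g⁻¹)).measurable

open scoped Pointwise in
theorem measurePreserving_rotSphere (g : SO 3) :
    MeasurePreserving (rotSphere g) sphereMeasure sphereMeasure := by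
  have hm : Measurable (rotSphere g) := (rotSphereEquiv g).measurable
  refine ⟨hm, Measure.ext fun s hs => ?_⟩
  rw [Measure.map_apply hm hs, Measure.toSphere_apply' _ (hm hs), Measure.toSphere_apply' _ hs]
  congr 1
  -- the cone over the preimage is the preimage of the cone, and rotations preserve volume
  have h : Set.Ioo (0 : ℝ) 1 • (Subtype.val '' (rotSphere g ⁻¹' s) : Set (E 3))
      = rot g ⁻¹' (Set.Ioo (0 : ℝ) 1 • (Subtype.val '' s)) := by
    ext v
    simp only [Set.mem_smul, Set.mem_image, Set.mem_preimage]
    constructor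
    · rintro ⟨t, ht, _, ⟨n, hn, rfl⟩, rfl⟩
      exact ⟨t, ht, _, ⟨_, hn, rfl⟩, by simp [rotSphere]⟩
    · rintro ⟨t, ht, _, ⟨n, hn, rfl⟩, hv⟩
      refine ⟨t, ht, _, ⟨rotSphere g⁻¹ n, by rwa [rotSphere_rotSphere_inv], rfl⟩, ?_⟩
      have := congrArg (rot g⁻¹) hv
      rw [rot_inv_rot] at this
      rw [← this]
      simp [rotSphere]
  rw [h]
  exact (measurePreserving_rot g).measure_preimage_equiv (f := (rot g).toMeasurableEquiv) _

/-! ### Harmonic decomposition of polynomials -/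

section Polynomials

open MvPolynomial

variable {𝕜 : Type*} [RCLike 𝕜]

variable (𝕜) in
/-- The polynomial `x₀² + x₁² + x₂²`. -/
def normSqPoly : MvPolynomial (Fin 3) 𝕜 := ∑ i, X i * X i

/-- The Laplacian on polynomials in three variables. -/
def laplacian : MvPolynomial (Fin 3) 𝕜 →ₗ[𝕜] MvPolynomial (Fin 3) 𝕜 :=
  ∑ i, (pderiv i).toLinearMap ∘ₗ (pderiv i).toLinearMap

theorem laplacian_apply (P : MvPolynomial (Fin 3) 𝕜) :
    laplacian P = ∑ i, pderiv i (pderiv i P) := by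
  simp [laplacian]

theorem laplacian_normSqPoly_mul (P : MvPolynomial (Fin 3) 𝕜) :
    laplacian (normSqPoly 𝕜 * P)
      = normSqPoly 𝕜 * laplacian P + 4 * (∑ i, X i * pderiv i P) + 6 * P := by
  simp only [laplacian_apply, normSqPoly, Fin.sum_univ_three, Derivation.leibniz, map_add,
    smul_eq_mul, pderiv_X_self]
  simp [pderiv_X]
  ring

theorem isHomogeneous_normSqPoly : (normSqPoly 𝕜).IsHomogeneous 2 :=
  IsHomogeneous.sum _ _ _ fun i _ => (isHomogeneous_X 𝕜 i).mul (isHomogeneous_X 𝕜 i)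

theorem isHomogeneous_normSqPoly_pow_mul {ℓ : ℕ} {H : MvPolynomial (Fin 3) 𝕜}
    (hH : H.IsHomogeneous ℓ) (j : ℕ) : (normSqPoly 𝕜 ^ j * H).IsHomogeneous (2 * j + ℓ) :=
  (isHomogeneous_normSqPoly.pow j).mul hH

theorem laplacian_normSqPoly_pow_mul {ℓ : ℕ} {H : MvPolynomial (Fin 3) 𝕜}
    (hH : H ∈ harmonicPolynomials 𝕜 ℓ) (j : ℕ) :
    laplacian (normSqPoly 𝕜 ^ (j + 1) * H)
      = (((2 * j + 2) * (2 * j + 2 * ℓ + 3) : ℕ) : 𝕜) • (normSqPoly 𝕜 ^ j * H) := by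
  have hE : ∀ j, ∑ i, X i * pderiv i (normSqPoly 𝕜 ^ j * H)
      = ((2 * j + ℓ : ℕ) : MvPolynomial (Fin 3) 𝕜) * (normSqPoly 𝕜 ^ j * H) := fun j => by
    rw [(isHomogeneous_normSqPoly_pow_mul hH.1 j).sum_X_mul_pderiv, nsmul_eq_mul]
  have hc : ∀ (m : ℕ) (Q : MvPolynomial (Fin 3) 𝕜), ((m : ℕ) : 𝕜) • Q = (m : MvPolynomial _ 𝕜) * Q :=
    fun m Q => by rw [Nat.cast_smul_eq_nsmul, nsmul_eq_mul]
  rw [hc]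
  induction j with
  | zero =>
    have h0 : laplacian H = 0 := by rw [laplacian_apply]; exact hH.2
    have := hE 0
    rw [pow_zero, one_mul] at this
    rw [zero_add, pow_one, laplacian_normSqPoly_mul, h0, this]
    push_cast
    ring
  | succ j ih =>
    rw [pow_succ', mul_assoc, laplacian_normSqPoly_mul, ih, hE]
    push_cast
    ring

variable (𝕜) in
/-- The span of the polynomials `|x|^{2j} H` of degree `m`, with `H` harmonic and homogeneous. -/
def harmonicSpan (m : ℕ) : Submodule 𝕜 (MvPolynomial (Fin 3) 𝕜) :=
  Submodule.span 𝕜 {P | ∃ j ℓ H, H ∈ harmonicPolynomials 𝕜 ℓ ∧ 2 * j + ℓ = m ∧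
    P = normSqPoly 𝕜 ^ j * H}

/-- The Laplacian maps the span of the `|x|^{2j} H` onto that of degree two less, because it
multiplies each `|x|^{2j} H` by a nonzero constant and lowers `j`. -/
theorem exists_laplacian_eq {m : ℕ} {P : MvPolynomial (Fin 3) 𝕜} (hP : P ∈ harmonicSpan 𝕜 m) :
    ∃ R ∈ harmonicSpan 𝕜 (m + 2), laplacian R = P := by
  change P ∈ (harmonicSpan 𝕜 (m + 2)).map laplacian
  refine Submodule.span_le.2 ?_ hP
  rintro _ ⟨j, ℓ, H, hH, rfl, rfl⟩
  have hc : (((2 * j + 2) * (2 * j + 2 * ℓ + 3) : ℕ) : 𝕜) ≠ 0 := by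
    rw [Nat.cast_ne_zero]; positivity
  refine ⟨(((2 * j + 2) * (2 * j + 2 * ℓ + 3) : ℕ) : 𝕜)⁻¹ • (normSqPoly 𝕜 ^ (j + 1) * H),
    Submodule.smul_mem _ _ (Submodule.subset_span ⟨j + 1, ℓ, H, hH, by ring, rfl⟩), ?_⟩
  rw [map_smul, laplacian_normSqPoly_pow_mul hH, smul_smul, inv_mul_cancel₀ hc, one_smul]

theorem laplacian_isHomogeneous {m : ℕ} {P : MvPolynomial (Fin 3) 𝕜}
    (hP : P.IsHomogeneous (m + 2)) : (laplacian P).IsHomogeneous m := by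
  rw [laplacian_apply]
  exact IsHomogeneous.sum _ _ _ fun i _ => hP.pderiv.pderiv

theorem pderiv_eq_zero_of_isHomogeneous_zero {P : MvPolynomial (Fin 3) 𝕜}
    (hP : P.IsHomogeneous 0) (i : Fin 3) : pderiv i P = 0 := by
  rw [totalDegree_eq_zero_iff_eq_C.1 ((totalDegree_zero_iff_isHomogeneous _).2 hP), pderiv_C]

/-- Every homogeneous polynomial is a combination of polynomials `|x|^{2j} H` with `H` harmonic. -/
theorem mem_harmonicSpan : ∀ {m : ℕ} {P : MvPolynomial (Fin 3) 𝕜},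
    P.IsHomogeneous m → P ∈ harmonicSpan 𝕜 m
  | 0, P, hP => Submodule.subset_span ⟨0, 0, P,
      ⟨hP, by simp [pderiv_eq_zero_of_isHomogeneous_zero hP]⟩, rfl, by simp⟩
  | 1, P, hP => Submodule.subset_span ⟨0, 1, P,
      ⟨hP, by simp [fun i => pderiv_eq_zero_of_isHomogeneous_zero (hP.pderiv (i := i))]⟩,
        rfl, by simp⟩
  | m + 2, P, hP => by
    obtain ⟨R, hR, hRP⟩ := exists_laplacian_eq (mem_harmonicSpan (laplacian_isHomogeneous hP))
    have hRm : R.IsHomogeneous (m + 2) := by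
      refine Submodule.span_le (p := homogeneousSubmodule (Fin 3) 𝕜 (m + 2)) |>.2 ?_ hR
      rintro _ ⟨j, ℓ, H, hH, hm, rfl⟩
      rw [← hm]
      exact isHomogeneous_normSqPoly_pow_mul hH.1 j
    have h : P - R ∈ harmonicSpan 𝕜 (m + 2) := Submodule.subset_span ⟨0, m + 2, P - R,
      ⟨hP.sub hRm, by rw [← laplacian_apply, map_sub, hRP, sub_self]⟩, by ring, by simp⟩
    simpa using add_mem h hR

theorem restrictSphere_normSqPoly (n : S2) : restrictSphere 𝕜 (normSqPoly 𝕜) n = 1 := by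
  have h : ‖n.1‖ ^ 2 = 1 := by rw [mem_sphere_zero_iff_norm.1 n.2, one_pow]
  rw [EuclideanSpace.norm_sq_eq] at h
  have h' := congrArg (fun t : ℝ => (t : 𝕜)) h
  simp only [Real.norm_eq_abs, sq_abs] at h'
  push_cast at h'
  rw [← h']
  simp [restrictSphere, normSqPoly, sq]

theorem restrictSphere_mul (P Q : MvPolynomial (Fin 3) 𝕜) (n : S2) :
    restrictSphere 𝕜 (P * Q) n = restrictSphere 𝕜 P n * restrictSphere 𝕜 Q n := by
  simp [restrictSphere]

/-- On the sphere every polynomial is a combination of spherical harmonics. -/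
theorem restrictSphere_mem_iSup (P : MvPolynomial (Fin 3) 𝕜) :
    restrictSphere 𝕜 P ∈ ⨆ ℓ, sphericalHarmonics 𝕜 ℓ := by
  have h : ∀ m (Q : MvPolynomial (Fin 3) 𝕜), Q.IsHomogeneous m →
      restrictSphere 𝕜 Q ∈ ⨆ ℓ, sphericalHarmonics 𝕜 ℓ := by
    intro m Q hQ
    have hQ' := mem_harmonicSpan hQ
    refine Submodule.span_le (p := (⨆ ℓ, sphericalHarmonics 𝕜 ℓ).comap (restrictSphere 𝕜)) |>.2 ?_
      hQ'
    rintro _ ⟨j, ℓ, H, hH, -, rfl⟩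
    have : restrictSphere 𝕜 (normSqPoly 𝕜 ^ j * H) = restrictSphere 𝕜 H := by
      ext n
      have h1 : restrictSphere 𝕜 (normSqPoly 𝕜 ^ j) n = restrictSphere 𝕜 (normSqPoly 𝕜) n ^ j := by
        simp [restrictSphere]
      rw [restrictSphere_mul, h1, restrictSphere_normSqPoly, one_pow, one_mul]
    change restrictSphere 𝕜 (normSqPoly 𝕜 ^ j * H) ∈ ⨆ ℓ, sphericalHarmonics 𝕜 ℓ
    rw [this]
    exact Submodule.mem_iSup_of_mem ℓ ⟨H, hH, rfl⟩
  rw [← sum_homogeneousComponent P, map_sum]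
  exact Submodule.sum_mem _ fun m _ => h m _ (homogeneousComponent_isHomogeneous m P)

/-! ### Infinitesimal rotations and the orthogonality of spherical harmonics -/

/-- The infinitesimal rotation `x_{k+1} ∂_{k+2} - x_{k+2} ∂_{k+1}` about the axis `k`, with
indices modulo 3. -/
def angular (k : Fin 3) : Derivation 𝕜 (MvPolynomial (Fin 3) 𝕜) (MvPolynomial (Fin 3) 𝕜) :=
  (X (k + 1) : MvPolynomial (Fin 3) 𝕜) • pderiv (k + 2)
    - (X (k + 2) : MvPolynomial (Fin 3) 𝕜) • pderiv (k + 1)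

theorem angular_apply (k : Fin 3) (P : MvPolynomial (Fin 3) 𝕜) :
    angular k P = X (k + 1) * pderiv (k + 2) P - X (k + 2) * pderiv (k + 1) P := rfl

theorem pderiv_pderiv_comm (i j : Fin 3) (P : MvPolynomial (Fin 3) 𝕜) :
    pderiv i (pderiv j P) = pderiv j (pderiv i P) := by
  have h : ⁅(pderiv i : Derivation 𝕜 (MvPolynomial (Fin 3) 𝕜) (MvPolynomial (Fin 3) 𝕜)), pderiv (R := 𝕜) j⁆ = 0 := by
    refine MvPolynomial.derivation_ext fun k => ?_
    rw [Derivation.commutator_apply]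
    simp only [pderiv_X, Pi.single_apply]
    split_ifs <;> simp
  have h2 := congrArg (fun D : Derivation 𝕜 (MvPolynomial (Fin 3) 𝕜) (MvPolynomial (Fin 3) 𝕜) => D P) h
  rw [Derivation.commutator_apply] at h2
  exact sub_eq_zero.1 h2

/-- The Casimir operator `∑ L_k²` in terms of the Laplacian and the Euler operator. -/
theorem sum_angular_angular (P : MvPolynomial (Fin 3) 𝕜) :
    ∑ k, angular k (angular k P) = normSqPoly 𝕜 * laplacian P
      - ∑ i, X i * pderiv i (∑ j, X j * pderiv j P) - ∑ i, X i * pderiv i P := by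
  simp only [laplacian_apply, normSqPoly, angular_apply, Fin.sum_univ_three, map_add, map_sub,
    Derivation.leibniz, smul_eq_mul, pderiv_X, Pi.single_apply, Fin.isValue, zero_add]
  have e1 : (1 : Fin 3) + 1 = 2 := rfl
  have e2 : (1 : Fin 3) + 2 = 0 := rfl
  have e3 : (2 : Fin 3) + 1 = 0 := rfl
  have e4 : (2 : Fin 3) + 2 = 1 := rfl
  simp only [e1, e2, e3, e4]
  rw [pderiv_pderiv_comm 1 0, pderiv_pderiv_comm 2 0, pderiv_pderiv_comm 2 1]
  simp
  ring

theorem sum_angular_angular_of_harmonic {ℓ : ℕ} {P : MvPolynomial (Fin 3) 𝕜}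
    (hP : P ∈ harmonicPolynomials 𝕜 ℓ) :
    ∑ k, angular k (angular k P) = -((ℓ * (ℓ + 1) : ℕ) : 𝕜) • P := by
  have h0 : laplacian P = 0 := by rw [laplacian_apply]; exact hP.2
  have hE := hP.1.sum_X_mul_pderiv
  rw [sum_angular_angular, h0, hE]
  simp only [map_nsmul, mul_smul_comm, ← Finset.smul_sum, hE]
  rw [neg_smul, Nat.cast_smul_eq_nsmul]
  simp only [nsmul_eq_mul]
  push_cast
  ring

end Polynomials

section SphereIntegrals

open MvPolynomial

variable {𝕜 : Type*} [RCLike 𝕜]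

theorem continuous_restrictSphere (P : MvPolynomial (Fin 3) 𝕜) :
    Continuous (restrictSphere 𝕜 P) := by
  refine (MvPolynomial.continuous_eval P).comp (continuous_pi fun i => ?_)
  exact RCLike.continuous_ofReal.comp ((continuous_apply i).comp
    ((PiLp.continuous_ofLp 2 _).comp continuous_subtype_val))

theorem _root_.Continuous.integrable_sphere {X : Type*} [NormedAddCommGroup X] {f : S2 → X}
    (hf : Continuous f) : Integrable f sphereMeasure :=
  hf.integrable_of_hasCompactSupport (HasCompactSupport.of_compactSpace f)

theorem integral_rotSphere {X : Type*} [NormedAddCommGroup X] [NormedSpace ℝ X] (g : SO 3)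
    (f : S2 → X) : ∫ n, f (rotSphere g n) ∂sphereMeasure = ∫ n, f n ∂sphereMeasure :=
  (measurePreserving_rotSphere g).integral_comp (rotSphereEquiv g).measurableEmbedding f

/-- The rotation by the angle `t` about the coordinate axis `k`. -/
def axisRot (k : Fin 3) (t : ℝ) : SO 3 :=
  ⟨![!![1, 0, 0; 0, Real.cos t, -Real.sin t; 0, Real.sin t, Real.cos t],
      !![Real.cos t, 0, Real.sin t; 0, 1, 0; -Real.sin t, 0, Real.cos t],
      !![Real.cos t, -Real.sin t, 0; Real.sin t, Real.cos t, 0; 0, 0, 1]] k, by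
    have h := Real.cos_sq_add_sin_sq t
    rw [Matrix.mem_specialOrthogonalGroup_iff, Matrix.mem_orthogonalGroup_iff]
    refine ⟨?_, ?_⟩
    · ext i j
      fin_cases k <;> fin_cases i <;> fin_cases j <;>
        simp [Matrix.mul_apply, Fin.sum_univ_three] <;> grind
    · fin_cases k <;> simp [Matrix.det_fin_three] <;> grind⟩

/-- The coordinates of the vector field generating the rotations about the axis `k`. -/
def angularField (k : Fin 3) (v : Fin 3 → ℝ) (i : Fin 3) : ℝ :=
  if i = k + 2 then v (k + 1) else if i = k + 1 then -v (k + 2) else 0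

theorem hasDerivAt_axisRot (k : Fin 3) (n : S2) (i : Fin 3) (t : ℝ) :
    HasDerivAt (fun t => (rotSphere (axisRot k t) n).1 i)
      (angularField k (fun j => (rotSphere (axisRot k t) n).1 j) i) t := by
  have hc : ∀ a, HasDerivAt (fun t => Real.cos t * a) (-Real.sin t * a) t := fun a =>
    (Real.hasDerivAt_cos t).mul_const a
  have hs : ∀ a, HasDerivAt (fun t => Real.sin t * a) (Real.cos t * a) t := fun a =>
    (Real.hasDerivAt_sin t).mul_const a
  have e1 : (1 : Fin 3) + 1 = 2 := rfl
  have e2 : (1 : Fin 3) + 2 = 0 := rfl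
  have e3 : (2 : Fin 3) + 1 = 0 := rfl
  have e4 : (2 : Fin 3) + 2 = 1 := rfl
  fin_cases k <;> fin_cases i <;>
    simp [rotSphere, rot, axisRot, angularField, dotProduct, Fin.sum_univ_three,
      e1, e2, e3, e4]
  all_goals first
    | exact hasDerivAt_const _ _
    | exact ((hc _).fun_add (hs _).fun_neg).congr_deriv (by ring)
    | exact ((hs _).fun_add (hc _)).congr_deriv (by ring)
    | exact ((hc _).fun_add (hs _)).congr_deriv (by ring)
    | exact ((hs _).fun_neg.fun_add (hc _)).congr_deriv (by ring)

theorem hasDerivAt_eval {x x' : ℝ → Fin 3 → ℝ} {t : ℝ}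
    (hx : ∀ i, HasDerivAt (fun t => x t i) (x' t i) t) (P : MvPolynomial (Fin 3) 𝕜) :
    HasDerivAt (fun t => eval (fun i => ((x t i : ℝ) : 𝕜)) P)
      (∑ i, ((x' t i : ℝ) : 𝕜) * eval (fun i => ((x t i : ℝ) : 𝕜)) (pderiv i P)) t := by
  induction P using MvPolynomial.induction_on with
  | C a => simpa using hasDerivAt_const t a
  | add P Q hP hQ =>
    simp only [map_add, mul_add, Finset.sum_add_distrib]
    exact hP.add hQ
  | mul_X P m hP =>
    have hm : HasDerivAt (fun t => ((x t m : ℝ) : 𝕜)) ((x' t m : ℝ) : 𝕜) t :=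
      (RCLike.ofRealCLM (K := 𝕜)).hasFDerivAt.comp_hasDerivAt t (hx m)
    have h := hP.mul hm
    have e : (fun t => eval (fun i => ((x t i : ℝ) : 𝕜)) (P * X m))
        = (fun t => eval (fun i => ((x t i : ℝ) : 𝕜)) P) * fun t => ((x t m : ℝ) : 𝕜) := by
      funext t
      rw [RingHom.map_mul, eval_X]
      rfl
    rw [e]
    convert h using 1
    simp [Derivation.leibniz, pderiv_X, Pi.single_apply, mul_add, Finset.sum_add_distrib,
      Finset.sum_mul]
    rw [add_comm]
    congr 1
    · exact Finset.sum_congr rfl fun i _ => by ring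
    · simp only [apply_ite (eval fun i => ((x t i : ℝ) : 𝕜)), RingHom.map_zero, mul_ite, mul_zero,
        Finset.sum_ite_eq, Finset.mem_univ, if_true]
      exact mul_comm _ _

theorem hasDerivAt_restrictSphere_axisRot (k : Fin 3) (P : MvPolynomial (Fin 3) 𝕜) (n : S2)
    (t : ℝ) : HasDerivAt (fun t => restrictSphere 𝕜 P (rotSphere (axisRot k t) n))
      (restrictSphere 𝕜 (angular k P) (rotSphere (axisRot k t) n)) t := by
  have h := hasDerivAt_eval (𝕜 := 𝕜) (x := fun t i => (rotSphere (axisRot k t) n).1 i)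
    (x' := fun t => angularField k fun j => (rotSphere (axisRot k t) n).1 j)
    (fun i => hasDerivAt_axisRot k n i t) P
  refine h.congr_deriv ?_
  have e1 : (1 : Fin 3) + 1 = 2 := rfl
  have e2 : (1 : Fin 3) + 2 = 0 := rfl
  have e3 : (2 : Fin 3) + 1 = 0 := rfl
  have e4 : (2 : Fin 3) + 2 = 1 := rfl
  rw [angular_apply]
  fin_cases k <;> simp [restrictSphere, angularField, Fin.sum_univ_three, e1, e2, e3, e4] <;> ring

/-- Infinitesimal rotations integrate to zero: differentiate the rotation invariance of the
surface measure. -/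
theorem integral_angular (k : Fin 3) (P : MvPolynomial (Fin 3) 𝕜) :
    ∫ n, restrictSphere 𝕜 (angular k P) n ∂sphereMeasure = 0 := by
  have hcont := continuous_restrictSphere (𝕜 := 𝕜)
  obtain ⟨C, hC⟩ := isCompact_univ.exists_bound_of_continuousOn (hcont (angular k P)).continuousOn
  have hr : ∀ t, Continuous fun n => rotSphere (axisRot k t) n := fun t =>
    continuous_rotSphere.comp (Continuous.prodMk_right _)
  have h := (hasDerivAt_integral_of_dominated_loc_of_deriv_le (μ := sphereMeasure) (x₀ := (0 : ℝ))
    (s := Set.univ) (bound := fun _ => C)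
    (F := fun t n => restrictSphere 𝕜 P (rotSphere (axisRot k t) n))
    (F' := fun t n => restrictSphere 𝕜 (angular k P) (rotSphere (axisRot k t) n))
    univ_mem (Eventually.of_forall fun t => ((hcont P).comp (hr t)).aestronglyMeasurable)
    ((hcont P).comp (hr 0)).integrable_sphere
    ((hcont _).comp (hr 0)).aestronglyMeasurable
    (Eventually.of_forall fun n t _ => hC _ (Set.mem_univ _)) (integrable_const C)
    (Eventually.of_forall fun n t _ => hasDerivAt_restrictSphere_axisRot k P n t)).2
  simp only [integral_rotSphere] at h
  exact h.unique (hasDerivAt_const _ _)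

theorem integral_angular_mul (k : Fin 3) (P Q : MvPolynomial (Fin 3) 𝕜) :
    ∫ n, restrictSphere 𝕜 (angular k P * Q) n ∂sphereMeasure
      = -∫ n, restrictSphere 𝕜 (P * angular k Q) n ∂sphereMeasure := by
  have h := integral_angular k (P * Q)
  rw [Derivation.leibniz, smul_eq_mul, smul_eq_mul, mul_comm Q, map_add] at h
  rw [eq_neg_iff_add_eq_zero, ← h, ← integral_add (continuous_restrictSphere _).integrable_sphere
    (continuous_restrictSphere _).integrable_sphere]
  exact integral_congr_ae (Eventually.of_forall fun n => add_comm _ _)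

/-- Harmonic polynomials of different degrees have orthogonal restrictions to the sphere: they
are eigenvectors of the symmetric operator `∑ L_k²` for different eigenvalues `-ℓ(ℓ+1)`. -/
theorem integral_harmonic_mul_harmonic {ℓ ℓ' : ℕ} (hne : ℓ ≠ ℓ') {P Q : MvPolynomial (Fin 3) 𝕜}
    (hP : P ∈ harmonicPolynomials 𝕜 ℓ) (hQ : Q ∈ harmonicPolynomials 𝕜 ℓ') :
    ∫ n, restrictSphere 𝕜 (P * Q) n ∂sphereMeasure = 0 := by
  have hint : ∀ R : MvPolynomial (Fin 3) 𝕜, Integrable (restrictSphere 𝕜 R) sphereMeasure :=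
    fun R => (continuous_restrictSphere R).integrable_sphere
  have hsum : ∀ R : Fin 3 → MvPolynomial (Fin 3) 𝕜,
      ∫ n, restrictSphere 𝕜 (∑ k, R k) n ∂sphereMeasure
        = ∑ k, ∫ n, restrictSphere 𝕜 (R k) n ∂sphereMeasure := fun R => by
    simp only [map_sum, Finset.sum_apply]
    exact integral_finsetSum _ fun k _ => hint _
  have hsmul : ∀ (c : 𝕜) (R : MvPolynomial (Fin 3) 𝕜),
      ∫ n, restrictSphere 𝕜 (c • R) n ∂sphereMeasure
        = c * ∫ n, restrictSphere 𝕜 R n ∂sphereMeasure := fun c R => by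
    simp only [map_smul, Pi.smul_apply, smul_eq_mul]
    exact integral_const_mul _ _
  have h : ∫ n, restrictSphere 𝕜 ((∑ k, angular k (angular k P)) * Q) n ∂sphereMeasure
      = ∫ n, restrictSphere 𝕜 (P * ∑ k, angular k (angular k Q)) n ∂sphereMeasure := by
    rw [Finset.sum_mul, Finset.mul_sum, hsum, hsum]
    exact Finset.sum_congr rfl fun k _ => by
      rw [integral_angular_mul, ← neg_eq_iff_eq_neg.2 (integral_angular_mul k P _)]
  rw [sum_angular_angular_of_harmonic hP, sum_angular_angular_of_harmonic hQ, smul_mul_assoc,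
    mul_smul_comm, hsmul, hsmul, ← sub_eq_zero, ← sub_mul] at h
  refine (mul_eq_zero.1 h).resolve_left fun h0 => hne ?_
  have h1 : ((ℓ * (ℓ + 1) : ℕ) : 𝕜) = ((ℓ' * (ℓ' + 1) : ℕ) : 𝕜) := by linear_combination -h0
  have h2 : ℓ * (ℓ + 1) = ℓ' * (ℓ' + 1) := Nat.cast_injective h1
  nlinarith [lt_trichotomy ℓ ℓ']

theorem restrictSphere_map_conj (P : MvPolynomial (Fin 3) 𝕜) (n : S2) :
    restrictSphere 𝕜 (MvPolynomial.map (starRingEnd 𝕜) P) n = conj (restrictSphere 𝕜 P n) := by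
  simp only [restrictSphere, LinearMap.coe_mk, AddHom.coe_mk]
  rw [eval_map, ← eval₂_id, hom_eval₂]
  simp

theorem map_conj_mem_harmonicPolynomials {ℓ : ℕ} {P : MvPolynomial (Fin 3) 𝕜}
    (hP : P ∈ harmonicPolynomials 𝕜 ℓ) :
    MvPolynomial.map (starRingEnd 𝕜) P ∈ harmonicPolynomials 𝕜 ℓ := by
  refine ⟨hP.1.map _, ?_⟩
  simp only [pderiv_map, ← map_sum, hP.2, map_zero]

theorem integral_conj_mul_of_ne {ℓ ℓ' : ℕ} (hne : ℓ ≠ ℓ') {f g : S2 → 𝕜}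
    (hf : f ∈ sphericalHarmonics 𝕜 ℓ) (hg : g ∈ sphericalHarmonics 𝕜 ℓ') :
    ∫ n, conj (f n) * g n ∂sphereMeasure = 0 := by
  obtain ⟨P, hP, rfl⟩ := hf
  obtain ⟨Q, hQ, rfl⟩ := hg
  rw [← integral_harmonic_mul_harmonic hne (map_conj_mem_harmonicPolynomials hP) hQ]
  simp only [restrictSphere_mul, restrictSphere_map_conj]

theorem continuous_of_mem_sphericalHarmonics {ℓ : ℕ} {f : S2 → 𝕜}
    (hf : f ∈ sphericalHarmonics 𝕜 ℓ) : Continuous f := by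
  obtain ⟨P, -, rfl⟩ := hf
  exact continuous_restrictSphere P

/-- The polynomial functions on the sphere, as a star subalgebra of the continuous functions. -/
def polynomialFunctions (𝕜 : Type*) [RCLike 𝕜] : StarSubalgebra 𝕜 C(S2, 𝕜) where
  carrier := {f | ∃ P : MvPolynomial (Fin 3) 𝕜, ⇑f = restrictSphere 𝕜 P}
  mul_mem' := by
    rintro f g ⟨P, hP⟩ ⟨Q, hQ⟩
    exact ⟨P * Q, by ext n; simp [restrictSphere_mul, hP, hQ]⟩
  add_mem' := by
    rintro f g ⟨P, hP⟩ ⟨Q, hQ⟩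
    exact ⟨P + Q, by simp [hP, hQ]⟩
  algebraMap_mem' c := ⟨C c, by ext n; simp [restrictSphere]⟩
  star_mem' := by
    rintro f ⟨P, hP⟩
    exact ⟨MvPolynomial.map (starRingEnd 𝕜) P, by ext n; simp [restrictSphere_map_conj, hP]⟩

theorem separatesPoints_polynomialFunctions : (polynomialFunctions 𝕜).SeparatesPoints := by
  intro n m hnm
  obtain ⟨i, hi⟩ : ∃ i, n.1 i ≠ m.1 i := by
    by_contra! h
    exact hnm (Subtype.ext (PiLp.ext h))
  refine ⟨_, ⟨⟨restrictSphere 𝕜 (X i), continuous_restrictSphere _⟩, ⟨X i, rfl⟩, rfl⟩, ?_⟩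
  simpa [restrictSphere] using hi

end SphereIntegrals

/-! ### Completeness of the spherical harmonics -/

section Completeness

variable {𝕜 : Type*} [RCLike 𝕜]

theorem continuous_harmonicBasis {ℓ : ℕ} (Y : HarmonicBasis 𝕜 ℓ) (k : Fin (2 * ℓ + 1)) :
    Continuous (Y k).1 :=
  continuous_of_mem_sphericalHarmonics (Y k).2

/-- The functions `Y_ℓ^k` of all degrees, as continuous functions on the sphere. -/
def harmonicMap (Y : ∀ ℓ, HarmonicBasis 𝕜 ℓ) (i : Σ ℓ, Fin (2 * ℓ + 1)) : C(S2, 𝕜) :=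
  ⟨(Y i.1 i.2).1, continuous_harmonicBasis (Y i.1) i.2⟩

/-- The functions `Y_ℓ^k` of all degrees, as elements of `L²(S²)`. -/
def harmonicLp (Y : ∀ ℓ, HarmonicBasis 𝕜 ℓ) (i : Σ ℓ, Fin (2 * ℓ + 1)) :
    Lp 𝕜 2 sphereMeasure :=
  ContinuousMap.toLp 2 sphereMeasure 𝕜 (harmonicMap Y i)

theorem harmonicLp_coeFn (Y : ∀ ℓ, HarmonicBasis 𝕜 ℓ) (i : Σ ℓ, Fin (2 * ℓ + 1)) :
    harmonicLp Y i =ᵐ[sphereMeasure] (Y i.1 i.2).1 :=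
  ContinuousMap.coeFn_toLp sphereMeasure (harmonicMap Y i)

theorem orthonormal_harmonicLp {Y : ∀ ℓ, HarmonicBasis 𝕜 ℓ}
    (hY : ∀ ℓ, IsOrthonormalBasis (Y ℓ)) : Orthonormal 𝕜 (harmonicLp Y) := by
  rw [orthonormal_iff_ite]
  rintro ⟨ℓ, k⟩ ⟨ℓ', k'⟩
  have h : inner 𝕜 (harmonicLp Y ⟨ℓ, k⟩) (harmonicLp Y ⟨ℓ', k'⟩)
      = ∫ n, conj ((Y ℓ k).1 n) * (Y ℓ' k').1 n ∂sphereMeasure := by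
    rw [harmonicLp, harmonicLp, ContinuousMap.inner_toLp]
    exact integral_congr_ae (Eventually.of_forall fun n => mul_comm _ _)
  rw [h]
  by_cases hl : ℓ = ℓ'
  · subst hl
    rw [hY ℓ k k']
    simp
  · rw [integral_conj_mul_of_ne hl (Y ℓ k).2 (Y ℓ' k').2, if_neg (by simp [hl])]

theorem polynomialFunctions_le_span (Y : ∀ ℓ, HarmonicBasis 𝕜 ℓ) {f : C(S2, 𝕜)}
    (hf : f ∈ polynomialFunctions 𝕜) : f ∈ Submodule.span 𝕜 (Set.range (harmonicMap Y)) := by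
  obtain ⟨P, hP⟩ := hf
  have h := restrictSphere_mem_iSup P
  have hle : (⨆ ℓ, sphericalHarmonics 𝕜 ℓ) ≤ (Submodule.span 𝕜 (Set.range (harmonicMap Y))).map
      (ContinuousMap.coeFnLinearMap 𝕜) := by
    refine iSup_le fun ℓ y hy => ?_
    have hs := congrArg Subtype.val ((Y ℓ).sum_repr ⟨y, hy⟩)
    rw [Submodule.coe_sum] at hs
    change _ = y at hs
    rw [← hs]
    refine Submodule.sum_mem _ fun k _ => ?_
    rw [Submodule.coe_smul]
    exact Submodule.smul_mem _ _ ⟨_, Submodule.subset_span ⟨⟨ℓ, k⟩, rfl⟩, rfl⟩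
  obtain ⟨g, hg, hgf⟩ := hle h
  have : g = f := DFunLike.coe_injective (hgf.trans hP.symm)
  exact this ▸ hg

theorem span_harmonicLp_dense (Y : ∀ ℓ, HarmonicBasis 𝕜 ℓ) :
    ⊤ ≤ (Submodule.span 𝕜 (Set.range (harmonicLp Y))).topologicalClosure := by
  set S := (Submodule.span 𝕜 (Set.range (harmonicLp Y))).topologicalClosure with hS
  have hSc : IsClosed (S : Set (Lp 𝕜 2 sphereMeasure)) := Submodule.isClosed_topologicalClosure _
  have h1 : ∀ f ∈ polynomialFunctions 𝕜, ContinuousMap.toLp 2 sphereMeasure 𝕜 f ∈ S := by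
    intro f hf
    refine Submodule.le_topologicalClosure _ ?_
    have h := Submodule.mem_map_of_mem
      (f := (ContinuousMap.toLp 2 sphereMeasure 𝕜 : C(S2, 𝕜) →L[𝕜] _).toLinearMap)
      (polynomialFunctions_le_span Y hf)
    rw [Submodule.map_span, ← Set.range_comp] at h
    exact h
  have h2 : ∀ f : C(S2, 𝕜), ContinuousMap.toLp 2 sphereMeasure 𝕜 f ∈ S := by
    intro f
    have htop := ContinuousMap.starSubalgebra_topologicalClosure_eq_top_of_separatesPoints
      (polynomialFunctions 𝕜) separatesPoints_polynomialFunctions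
    have hf : f ∈ closure (polynomialFunctions 𝕜 : Set C(S2, 𝕜)) := by
      rw [← StarSubalgebra.topologicalClosure_coe, htop]
      trivial
    exact closure_minimal (t := (ContinuousMap.toLp 2 sphereMeasure 𝕜) ⁻¹'
      (S : Set (Lp 𝕜 2 sphereMeasure))) h1 (hSc.preimage (ContinuousLinearMap.continuous _)) hf
  intro F _
  have hd := ContinuousMap.toLp_denseRange 𝕜 sphereMeasure (p := 2) 𝕜 (by simp) F
  exact closure_minimal (t := (S : Set (Lp 𝕜 2 sphereMeasure))) (by rintro _ ⟨f, rfl⟩; exact h2 f) hSc hd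

/-- The `ℓ`-th term of the harmonic expansion of a vector-valued function on the sphere. -/
def harmonicTerm {X : Type*} [NormedAddCommGroup X] [NormedSpace 𝕜 X] [NormedSpace ℝ X] {ℓ : ℕ}
    (Y : HarmonicBasis 𝕜 ℓ) (g : S2 → X) (n : S2) : X :=
  ∑ k, (Y k).1 n • ∫ m, conj ((Y k).1 m) • g m ∂sphereMeasure

theorem tendsto_harmonicTerm_scalar {Y : ∀ ℓ, HarmonicBasis 𝕜 ℓ}
    (hY : ∀ ℓ, IsOrthonormalBasis (Y ℓ)) {f : S2 → 𝕜} (hf : MemLp f 2 sphereMeasure) :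
    Tendsto (fun N => eLpNorm (fun n => f n - ∑ ℓ ∈ Finset.range N, harmonicTerm (Y ℓ) f n) 2
      sphereMeasure) atTop (𝓝 0) := by
  set b := HilbertBasis.mk (orthonormal_harmonicLp hY) (span_harmonicLp_dense Y) with hb
  have hs := b.hasSum_repr hf.toLp
  have hN : Tendsto (fun N => (Finset.range N).sigma fun ℓ => (Finset.univ : Finset (Fin (2 * ℓ + 1))))
      atTop atTop := by
    refine tendsto_atTop_finset_of_monotone (fun N M h =>
      Finset.sigma_mono (Finset.range_mono h) fun _ => le_rfl) fun i => ⟨i.1 + 1, by simp⟩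
  have ht := hs.comp hN
  have hr : ∀ i : Σ ℓ, Fin (2 * ℓ + 1), b.repr hf.toLp i
      = ∫ m, conj ((Y i.1 i.2).1 m) • f m ∂sphereMeasure := by
    intro i
    rw [b.repr_apply_apply, L2.inner_def, hb, HilbertBasis.coe_mk]
    refine integral_congr_ae ?_
    filter_upwards [harmonicLp_coeFn Y i, hf.coeFn_toLp] with m h1 h2
    rw [h1, h2, RCLike.inner_apply, smul_eq_mul, mul_comm]
  rw [Lp.tendsto_Lp_iff_tendsto_eLpNorm'] at ht
  refine ht.congr fun N => ?_
  rw [← eLpNorm_neg]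
  refine eLpNorm_congr_ae ?_
  simp only [Function.comp_apply]
  have hsum : ∀ s : Finset (Σ ℓ, Fin (2 * ℓ + 1)),
      ⇑(∑ i ∈ s, b.repr hf.toLp i • b i) =ᵐ[sphereMeasure]
        fun n => ∑ i ∈ s, (Y i.1 i.2).1 n • ∫ m, conj ((Y i.1 i.2).1 m) • f m ∂sphereMeasure := by
    intro s
    have h : ∀ᵐ n ∂sphereMeasure, ∀ i ∈ s, (b.repr hf.toLp i • b i : Lp 𝕜 2 sphereMeasure) n
        = (Y i.1 i.2).1 n • ∫ m, conj ((Y i.1 i.2).1 m) • f m ∂sphereMeasure := by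
      refine (eventually_all_finset s).2 fun i _ => ?_
      filter_upwards [harmonicLp_coeFn Y i, Lp.coeFn_smul (b.repr hf.toLp i) (b i)] with n h1 h2
      rw [h2, Pi.smul_apply, hr, hb, HilbertBasis.coe_mk, h1]
      exact mul_comm _ _
    filter_upwards [h, Lp.coeFn_finsetSum s fun i => b.repr hf.toLp i • b i] with n h1 h2
    rw [h2, Finset.sum_apply]
    exact Finset.sum_congr rfl h1
  filter_upwards [hf.coeFn_toLp, hsum ((Finset.range N).sigma fun ℓ => Finset.univ)] with n h1 h2
  rw [Pi.neg_apply, Pi.sub_apply, h1, h2, neg_sub, Finset.sum_sigma]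
  rfl

section Vector

variable {X : Type*} [NormedAddCommGroup X] [NormedSpace 𝕜 X]

theorem continuous_harmonicTerm [NormedSpace ℝ X] {ℓ : ℕ} (Y : HarmonicBasis 𝕜 ℓ) (g : S2 → X) :
    Continuous (harmonicTerm Y g) :=
  continuous_finsetSum _ fun k _ => (continuous_harmonicBasis Y k).smul continuous_const

theorem integrable_conj_smul {ℓ : ℕ} (Y : HarmonicBasis 𝕜 ℓ) (k : Fin (2 * ℓ + 1)) {g : S2 → X}
    (hg : MemLp g 2 sphereMeasure) :
    Integrable (fun m => conj ((Y k).1 m) • g m) sphereMeasure := by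
  have hc : Continuous fun m => conj ((Y k).1 m) :=
    RCLike.continuous_conj.comp (continuous_harmonicBasis Y k)
  obtain ⟨C, hC⟩ := isCompact_univ.exists_bound_of_continuousOn hc.continuousOn
  exact (hg.integrable (by norm_num)).bdd_smul C hc.aestronglyMeasurable
    (Eventually.of_forall fun m => hC m (Set.mem_univ m))

/-- The harmonic expansion of a square-integrable function on the sphere with values in a
finite-dimensional space converges in `L²(S²)`. -/
theorem isL2Series_harmonicTerm [FiniteDimensional 𝕜 X] [NormedSpace ℝ X]
    [IsScalarTower ℝ 𝕜 X] {Y : ∀ ℓ, HarmonicBasis 𝕜 ℓ}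
    (hY : ∀ ℓ, IsOrthonormalBasis (Y ℓ)) {g : S2 → X} (hg : MemLp g 2 sphereMeasure) :
    IsL2Series g fun ℓ => harmonicTerm (Y ℓ) g := by
  refine ⟨hg, fun ℓ => (continuous_harmonicTerm (Y ℓ) g).memLp_of_hasCompactSupport
    (HasCompactSupport.of_compactSpace _), ?_⟩
  have := FiniteDimensional.complete 𝕜 X
  let b := Module.finBasis 𝕜 X
  let c : Fin (Module.finrank 𝕜 X) → X →L[𝕜] 𝕜 := fun j => LinearMap.toContinuousLinearMap (b.coord j)
  have hbc : ∀ x : X, ∑ j, c j x • b j = x := fun x => b.sum_repr x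
  have hcg : ∀ j, MemLp (fun n => c j (g n)) 2 sphereMeasure := fun j => (c j).comp_memLp' hg
  have hct : ∀ j ℓ n, c j (harmonicTerm (Y ℓ) g n) = harmonicTerm (Y ℓ) (fun n => c j (g n)) n := by
    intro j ℓ n
    simp only [harmonicTerm, map_sum, map_smul]
    refine Finset.sum_congr rfl fun k _ => ?_
    rw [← (c j).integral_comp_comm (integrable_conj_smul (Y ℓ) k hg)]
    simp only [map_smul]
  have hlim : Tendsto (fun N => ∑ j, ‖b j‖ₑ * eLpNorm (fun n => c j (g n)
      - ∑ ℓ ∈ Finset.range N, harmonicTerm (Y ℓ) (fun n => c j (g n)) n) 2 sphereMeasure)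
      atTop (𝓝 0) := by
    have := tendsto_finsetSum Finset.univ fun j (_ : j ∈ Finset.univ) =>
      ENNReal.Tendsto.const_mul (a := ‖b j‖ₑ) (tendsto_harmonicTerm_scalar hY (hcg j))
        (Or.inr enorm_ne_top)
    simpa using this
  refine tendsto_of_tendsto_of_tendsto_of_le_of_le tendsto_const_nhds hlim (fun _ => zero_le)
    fun N => ?_
  have he : (fun n => g n - ∑ ℓ ∈ Finset.range N, harmonicTerm (Y ℓ) g n)
      = ∑ j, fun n => (c j (g n) - ∑ ℓ ∈ Finset.range N, harmonicTerm (Y ℓ) (fun n => c j (g n)) n)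
        • b j := by
    funext n
    rw [Finset.sum_apply]
    simp only [← hct, ← map_sum, ← map_sub, hbc]
  have hm : ∀ j, AEStronglyMeasurable (fun n => c j (g n)
      - ∑ ℓ ∈ Finset.range N, harmonicTerm (Y ℓ) (fun n => c j (g n)) n) sphereMeasure := fun j =>
    (hcg j).1.sub (continuous_finsetSum _ fun ℓ _ =>
      continuous_harmonicTerm (Y ℓ) _).aestronglyMeasurable
  change eLpNorm (fun n => g n - ∑ ℓ ∈ Finset.range N, harmonicTerm (Y ℓ) g n) 2 sphereMeasure ≤ _
  rw [he]
  refine (eLpNorm_sum_le (fun j _ => (hm j).smul_const (b j)) (by norm_num)).trans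
    (Finset.sum_le_sum fun j _ => ?_)
  exact eLpNorm_le_nnreal_smul_eLpNorm_of_ae_le_mul (c := ‖b j‖₊)
    (Eventually.of_forall fun n => by rw [nnnorm_smul, mul_comm]) 2

end Vector

end Completeness

/-! ### Integral operators with kernels that are square-integrable in the output variable -/

section Minkowski

variable {α β : Type*} [MeasurableSpace α] [MeasurableSpace β] {μ : Measure α} {ν : Measure β}

theorem eLpNorm_two_eq {X : Type*} [NormedAddCommGroup X] (f : α → X) :
    eLpNorm f 2 μ = (∫⁻ a, ‖f a‖ₑ ^ (2 : ℝ) ∂μ) ^ (1 / 2 : ℝ) := by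
  rw [eLpNorm_eq_lintegral_rpow_enorm_toReal (by norm_num) (by norm_num)]
  simp

theorem lintegral_mul_le_rpow_half {f g : α → ℝ≥0∞} (hf : Measurable f) (hg : Measurable g) :
    ∫⁻ a, f a * g a ∂μ
      ≤ (∫⁻ a, f a ^ (2 : ℝ) ∂μ) ^ (1 / 2 : ℝ) * (∫⁻ a, g a ^ (2 : ℝ) ∂μ) ^ (1 / 2 : ℝ) :=
  ENNReal.lintegral_mul_le_Lp_mul_Lq μ (Real.HolderConjugate.two_two) hf.aemeasurable
    hg.aemeasurable

/-- Minkowski's integral inequality in `L²`. -/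
theorem lintegral_lintegral_sq_le [SFinite μ] [SFinite ν] {φ : α × β → ℝ≥0∞} (hφ : Measurable φ) :
    ∫⁻ a, (∫⁻ b, φ (a, b) ∂ν) ^ 2 ∂μ
      ≤ (∫⁻ b, (∫⁻ a, φ (a, b) ^ (2 : ℝ) ∂μ) ^ (1 / 2 : ℝ) ∂ν) ^ 2 := by
  have hl : ∀ a, Measurable fun b => φ (a, b) := fun a => by fun_prop
  have hr : ∀ b, Measurable fun a => φ (a, b) := fun b => by fun_prop
  have hN : Measurable fun b => (∫⁻ a, φ (a, b) ^ (2 : ℝ) ∂μ) ^ (1 / 2 : ℝ) :=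
    (Measurable.lintegral_prod_left' (hφ.pow_const _)).pow_const _
  -- write the square as a double integral over `(b, b')` and apply Cauchy-Schwarz in `a`
  calc ∫⁻ a, (∫⁻ b, φ (a, b) ∂ν) ^ 2 ∂μ
      = ∫⁻ a, ∫⁻ q : β × β, φ (a, q.1) * φ (a, q.2) ∂(ν.prod ν) ∂μ := by
        refine lintegral_congr fun a => ?_
        rw [sq, lintegral_prod_mul (hl a).aemeasurable (hl a).aemeasurable]
    _ = ∫⁻ q : β × β, ∫⁻ a, φ (a, q.1) * φ (a, q.2) ∂μ ∂(ν.prod ν) := by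
        refine lintegral_lintegral_swap (Measurable.aemeasurable ?_)
        exact (hφ.comp (by fun_prop : Measurable fun x : α × (β × β) => (x.1, x.2.1))).mul
          (hφ.comp (by fun_prop : Measurable fun x : α × (β × β) => (x.1, x.2.2)))
    _ ≤ ∫⁻ q : β × β, (∫⁻ a, φ (a, q.1) ^ (2 : ℝ) ∂μ) ^ (1 / 2 : ℝ)
          * (∫⁻ a, φ (a, q.2) ^ (2 : ℝ) ∂μ) ^ (1 / 2 : ℝ) ∂(ν.prod ν) :=
        lintegral_mono fun q => lintegral_mul_le_rpow_half (hr q.1) (hr q.2)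
    _ = _ := by
        rw [lintegral_prod_mul hN.aemeasurable hN.aemeasurable, sq]

theorem measurable_eLpNorm_two {X : Type*} [NormedAddCommGroup X] [SFinite μ] {k : α × β → X}
    (hk : StronglyMeasurable k) : Measurable fun b => eLpNorm (fun a => k (a, b)) 2 μ := by
  simp only [eLpNorm_two_eq]
  exact (Measurable.lintegral_prod_left' (hk.enorm.pow_const _)).pow_const _

variable {𝕜 : Type*} [RCLike 𝕜]
variable {V : Type*} [NormedAddCommGroup V] [NormedSpace 𝕜 V]
variable {V' : Type*} [NormedAddCommGroup V'] [NormedSpace 𝕜 V']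

theorem aestronglyMeasurable_kernel_apply [SFinite μ] [SFinite ν] {k : α × β → (V →L[𝕜] V')}
    (hk : StronglyMeasurable k) {f : β → V} (hf : AEStronglyMeasurable f ν) :
    AEStronglyMeasurable (fun q : α × β => k q (f q.2)) (μ.prod ν) :=
  (ContinuousLinearMap.apply 𝕜 V' : V →L[𝕜] (V →L[𝕜] V') →L[𝕜] V').aestronglyMeasurable_comp₂
    hf.comp_snd hk.aestronglyMeasurable

theorem memLp_two_integral_kernel [NormedSpace ℝ V'] [SFinite μ] [SFinite ν] {k : α × β → (V →L[𝕜] V')}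
    (hk : StronglyMeasurable k) {f : β → V} (hf : AEStronglyMeasurable f ν)
    (hfin : ∫⁻ b, eLpNorm (fun a => k (a, b)) 2 μ * ‖f b‖ₑ ∂ν < ∞) :
    MemLp (fun a => ∫ b, k (a, b) (f b) ∂ν) 2 μ := by
  obtain ⟨f', hf', hff'⟩ := hf
  have he : (fun a => ∫ b, k (a, b) (f b) ∂ν) = fun a => ∫ b, k (a, b) (f' b) ∂ν := by
    funext a
    refine integral_congr_ae ?_
    filter_upwards [hff'] with b hb
    rw [hb]
  have hfin' : ∫⁻ b, eLpNorm (fun a => k (a, b)) 2 μ * ‖f' b‖ₑ ∂ν < ∞ := by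
    refine lt_of_eq_of_lt (lintegral_congr_ae ?_) hfin
    filter_upwards [hff'] with b hb
    rw [hb]
  rw [he]
  refine ⟨(aestronglyMeasurable_kernel_apply hk hf'.aestronglyMeasurable).integral_prod_right', ?_⟩
  have hm : Measurable fun q : α × β => ‖k q‖ₑ * ‖f' q.2‖ₑ :=
    hk.enorm.mul (hf'.enorm.comp measurable_snd)
  have h1 := lintegral_lintegral_sq_le (μ := μ) (ν := ν) hm
  have h2 : ∀ b, (∫⁻ a, (‖k (a, b)‖ₑ * ‖f' b‖ₑ) ^ (2 : ℝ) ∂μ) ^ (1 / 2 : ℝ)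
      = eLpNorm (fun a => k (a, b)) 2 μ * ‖f' b‖ₑ := by
    intro b
    have h3 : ∀ a, (‖k (a, b)‖ₑ * ‖f' b‖ₑ) ^ (2 : ℝ) = ‖k (a, b)‖ₑ ^ (2 : ℝ) * ‖f' b‖ₑ ^ (2 : ℝ) :=
      fun a => ENNReal.mul_rpow_of_nonneg _ _ (by norm_num)
    simp only [h3]
    rw [lintegral_mul_const' _ _ (ENNReal.rpow_ne_top_of_nonneg (by norm_num) enorm_ne_top),
      ENNReal.mul_rpow_of_nonneg _ _ (by norm_num), eLpNorm_two_eq, ← ENNReal.rpow_mul]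
    norm_num
  simp only [h2] at h1
  rw [eLpNorm_two_eq]
  refine ENNReal.rpow_lt_top_of_nonneg (by norm_num) (ne_of_lt ?_)
  refine lt_of_le_of_lt ?_ (h1.trans_lt (ENNReal.pow_lt_top hfin'))
  refine lintegral_mono fun a => ?_
  rw [ENNReal.rpow_two]
  gcongr
  refine (enorm_integral_le_lintegral_enorm _).trans (lintegral_mono fun b => ?_)
  exact (k (a, b)).le_opENorm (f' b)

/-- The pairing of `n ↦ k(n, r) f(r)` with a square-integrable function of `n` is absolutely
integrable in `(n, r)`. -/
theorem integrable_prod_smul_kernel [SFinite μ] [SFinite ν] {k : α × β → (V →L[𝕜] V')}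
    (hk : StronglyMeasurable k) {f : β → V} (hf : AEStronglyMeasurable f ν)
    (hfin : ∫⁻ b, eLpNorm (fun a => k (a, b)) 2 μ * ‖f b‖ₑ ∂ν < ∞) {y : α → 𝕜}
    (hy : MemLp y 2 μ) :
    Integrable (fun q : α × β => y q.1 • k q (f q.2)) (μ.prod ν) := by
  have hm : AEStronglyMeasurable (fun q : α × β => y q.1 • k q (f q.2)) (μ.prod ν) :=
    hy.1.comp_fst.smul (aestronglyMeasurable_kernel_apply hk hf)
  refine ⟨hm, ?_⟩
  rw [hasFiniteIntegral_iff_enorm, lintegral_prod_symm _ hm.enorm]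
  refine lt_of_le_of_lt (b := ∫⁻ b, eLpNorm y 2 μ * (eLpNorm (fun a => k (a, b)) 2 μ * ‖f b‖ₑ) ∂ν)
    (lintegral_mono fun b => ?_) ?_
  · calc ∫⁻ a, ‖y a • k (a, b) (f b)‖ₑ ∂μ
        ≤ ∫⁻ a, ‖y a • k (a, b)‖ₑ * ‖f b‖ₑ ∂μ :=
          lintegral_mono fun a => (y a • k (a, b)).le_opENorm (f b)
      _ = eLpNorm (y • fun a => k (a, b)) 1 μ * ‖f b‖ₑ := by
          rw [lintegral_mul_const' _ _ enorm_ne_top, eLpNorm_one_eq_lintegral_enorm]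
          rfl
      _ ≤ (eLpNorm y 2 μ * eLpNorm (fun a => k (a, b)) 2 μ) * ‖f b‖ₑ := by
          gcongr
          exact eLpNorm_smul_le_mul_eLpNorm
            (hk.comp_measurable measurable_prodMk_right).aestronglyMeasurable hy.1
      _ = _ := mul_assoc _ _ _
  · rw [lintegral_const_mul' _ _ hy.2.ne]
    exact ENNReal.mul_lt_top hy.2 hfin

end Minkowski

/-! ### A kernel is determined by its integrals against test fields -/

section Uniqueness

variable {𝕜 : Type*} [RCLike 𝕜]
variable {V : Type*} [NormedAddCommGroup V] [NormedSpace 𝕜 V] [FiniteDimensional 𝕜 V]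
variable {V' : Type*} [NormedAddCommGroup V'] [NormedSpace 𝕜 V'] [NormedSpace ℝ V']
  [IsScalarTower ℝ 𝕜 V'] [CompleteSpace V']

theorem ae_eq_of_integral_testFields_eq {k k' : E 2 → (V →L[𝕜] V')}
    (hk : ∀ f : E 2 → V, Continuous f → HasCompactSupport f → Integrable fun r => k r (f r))
    (hk' : ∀ f : E 2 → V, Continuous f → HasCompactSupport f → Integrable fun r => k' r (f r))
    (h : ∀ f : E 2 → V, Continuous f → HasCompactSupport f →
      ∫ r, k r (f r) = ∫ r, k' r (f r)) :
    k =ᵐ[volume] k' := by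
  have hfield : ∀ (v : V) (φ : E 2 → ℝ), Continuous φ → HasCompactSupport φ →
      Continuous (fun r => ((φ r : ℝ) : 𝕜) • v) ∧ HasCompactSupport fun r => ((φ r : ℝ) : 𝕜) • v :=
    fun v φ hφ hs => ⟨(RCLike.continuous_ofReal.comp hφ).smul continuous_const,
      hs.comp_left (g := fun t : ℝ => (t : 𝕜) • v) (by simp)⟩
  have happ : ∀ (l : V →L[𝕜] V') (t : ℝ) (v : V), l ((t : 𝕜) • v) = t • l v := fun l t v => by
    rw [map_smul, RCLike.real_smul_eq_coe_smul (K := 𝕜)]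
  have hv : ∀ v : V, ∀ᵐ r, k r v = k' r v := by
    intro v
    have hint : ∀ φ : E 2 → ℝ, Continuous φ → HasCompactSupport φ →
        Integrable (fun r => φ r • (k r v - k' r v)) ∧ ∫ r, φ r • (k r v - k' r v) = 0 := by
      intro φ hφ hs
      obtain ⟨h1, h2⟩ := hfield v φ hφ hs
      have i1 := hk _ h1 h2
      have i2 := hk' _ h1 h2
      have i3 := h _ h1 h2
      simp only [happ] at i1 i2 i3
      simp only [smul_sub]
      exact ⟨i1.sub i2, by rw [integral_sub i1 i2, i3, sub_self]⟩
    have hloc : LocallyIntegrable (fun r => k r v - k' r v) := by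
      refine locallyIntegrable_iff.2 fun K hK => ?_
      obtain ⟨φ, hφ1, -, hφs, -⟩ :=
        exists_continuous_one_zero_of_isCompact hK isClosed_empty (Set.disjoint_empty K)
      refine (integrableOn_congr_fun (fun r hr => ?_) hK.measurableSet).1
        ((hint φ φ.continuous hφs).1.integrableOn (s := K))
      have := hφ1 hr
      simp only [Pi.one_apply] at this
      simp only [this, one_smul]
    filter_upwards [ae_eq_zero_of_integral_contDiff_smul_eq_zero hloc
      fun φ hφ hs => (hint φ hφ.continuous hs).2] with r hr
    exact sub_eq_zero.1 hr
  have hall : ∀ᵐ r, ∀ i, k r (Module.finBasis 𝕜 V i) = k' r (Module.finBasis 𝕜 V i) :=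
    ae_all_iff.2 fun i => hv _
  filter_upwards [hall] with r hr
  exact ContinuousLinearMap.coe_injective ((Module.finBasis 𝕜 V).ext hr)

end Uniqueness

/-! ### Averaging a kernel over the in-plane rotations -/

section Averaging

variable {𝕜 : Type*} [RCLike 𝕜]
variable {X : Type*} [NormedAddCommGroup X] [NormedSpace 𝕜 X]

/-- The operators of a representation by bounded operators, as linear homeomorphisms. -/
def repEquiv {G : Type*} [Group G] (σ : G →* (X →L[𝕜] X)) (h : G) : X ≃L[𝕜] X :=
  ContinuousLinearEquiv.equivOfInverse (σ h) (σ h⁻¹)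
    (fun x => by
      rw [← mul_apply_eq_comp, ← map_mul, inv_mul_cancel, map_one,
        one_apply_eq_self])
    (fun x => by
      rw [← mul_apply_eq_comp, ← map_mul, mul_inv_cancel, map_one,
        one_apply_eq_self])

theorem ae_ae_eq_comm {α β : Type*} [MeasurableSpace α] [MeasurableSpace β] {μ : Measure α}
    {ν : Measure β} [SFinite μ] [SFinite ν] {k k' : α × β → X} (hk : StronglyMeasurable k)
    (hk' : StronglyMeasurable k') :
    (∀ᵐ a ∂μ, ∀ᵐ b ∂ν, k (a, b) = k' (a, b)) ↔ ∀ᵐ b ∂ν, ∀ᵐ a ∂μ, k (a, b) = k' (a, b) :=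
  Measure.ae_ae_comm (p := fun a b => k (a, b) = k' (a, b)) (hk.measurableSet_eq_fun hk')

/-- An in-plane rotation acting on directions and on points of the image plane. -/
def rotPair (h : SO 2) (q : S2 × E 2) : S2 × E 2 := (rotSphere (inclSO h) q.1, rot h q.2)

theorem rotPair_mul (g h : SO 2) (q : S2 × E 2) : rotPair (g * h) q = rotPair g (rotPair h q) := by
  simp [rotPair, rotSphere_mul]

theorem continuous_rotPair : Continuous fun p : SO 2 × (S2 × E 2) => rotPair p.1 p.2 :=
  (continuous_rotSphere.comp ((continuous_inclSO.comp continuous_fst).prodMk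
    (continuous_fst.comp continuous_snd))).prodMk
    (continuous_rot.comp (continuous_fst.prodMk (continuous_snd.comp continuous_snd)))

/-- A kernel that is covariant under in-plane rotations up to null sets can be replaced by its
average over `SO(2)`, which is covariant everywhere, because the average is covariant even at the
points where it is the junk value of a divergent integral. -/
theorem exists_covariant_of_ae_covariant [CompleteSpace X] [NormedSpace ℝ X]
    (σ : SO 2 →* (X →L[𝕜] X)) (hσ : Continuous σ) {k₀ : S2 × E 2 → X} (hk₀ : StronglyMeasurable k₀)
    (hcov : ∀ h n, ∀ᵐ r, k₀ (rotPair h (n, r)) = σ h (k₀ (n, r))) :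
    ∃ k : S2 × E 2 → X, StronglyMeasurable k ∧ (∀ h q, k (rotPair h q) = σ h (k q)) ∧
      ∀ n, ∀ᵐ r, k (n, r) = k₀ (n, r) := by
  borelize (SO 2)
  let μ : Measure (SO 2) := Measure.haarMeasure ⊤
  have hμ : IsProbabilityMeasure μ := ⟨by
    have := Measure.haarMeasure_self (G := SO 2) (K₀ := ⊤)
    rwa [TopologicalSpace.PositiveCompacts.coe_top] at this⟩
  have hF : StronglyMeasurable fun p : (S2 × E 2) × SO 2 => σ p.2 (k₀ (rotPair p.2⁻¹ p.1)) := by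
    have h1 : Continuous fun x : (X →L[𝕜] X) × X => x.1 x.2 := by fun_prop
    have h2 : StronglyMeasurable fun p : (S2 × E 2) × SO 2 => σ p.2 :=
      (hσ.comp continuous_snd).stronglyMeasurable
    have h3 : Measurable fun p : (S2 × E 2) × SO 2 => rotPair p.2⁻¹ p.1 :=
      (continuous_rotPair.comp (continuous_snd.inv.prodMk continuous_fst)).measurable
    exact h1.comp_stronglyMeasurable (h2.prodMk (hk₀.comp_measurable h3))
  refine ⟨fun q => ∫ h, σ h (k₀ (rotPair h⁻¹ q)) ∂μ, hF.integral_prod_right', ?_, ?_⟩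
  · intro g q
    calc ∫ h, σ h (k₀ (rotPair h⁻¹ (rotPair g q))) ∂μ
        = ∫ h, σ (g * h) (k₀ (rotPair (g * h)⁻¹ (rotPair g q))) ∂μ :=
          (integral_mul_left_eq_self (μ := μ)
            (fun h => σ h (k₀ (rotPair h⁻¹ (rotPair g q)))) g).symm
      _ = ∫ h, repEquiv σ g (σ h (k₀ (rotPair h⁻¹ q))) ∂μ := by
          refine integral_congr_ae (Eventually.of_forall fun h => ?_)
          simp only [← rotPair_mul, mul_inv_rev, inv_mul_cancel_right, map_mul]
          rfl
      _ = σ g (∫ h, σ h (k₀ (rotPair h⁻¹ q)) ∂μ) := (repEquiv σ g).integral_comp_comm _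
  · intro n
    have h1 : ∀ h : SO 2, ∀ᵐ r, σ h (k₀ (rotPair h⁻¹ (n, r))) = k₀ (n, r) := by
      intro h
      have h2 := (measurePreserving_rot h⁻¹).quasiMeasurePreserving.ae
        (hcov h (rotSphere (inclSO h⁻¹) n))
      filter_upwards [h2] with r hr
      have h3 : (rotSphere (inclSO h⁻¹) n, rot h⁻¹ r) = rotPair h⁻¹ (n, r) := rfl
      rw [h3, ← rotPair_mul, mul_inv_cancel] at hr
      rw [← hr]
      simp [rotPair, rotSphere_one]
    have hm1 : StronglyMeasurable fun p : SO 2 × E 2 => σ p.1 (k₀ (rotPair p.1⁻¹ (n, p.2))) :=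
      hF.comp_measurable (g := fun p : SO 2 × E 2 => ((n, p.2), p.1)) (by fun_prop)
    have hm2 : StronglyMeasurable fun p : SO 2 × E 2 => k₀ (n, p.2) :=
      hk₀.comp_measurable (by fun_prop)
    have h4 := (ae_ae_eq_comm (μ := μ) hm1 hm2).1 (Eventually.of_forall h1)
    filter_upwards [h4] with r hr
    rw [integral_congr_ae hr]
    simp

theorem eLpNorm_rotPair_le (σ : SO 2 →* (X →L[𝕜] X)) {k : S2 × E 2 → X}
    (hk : StronglyMeasurable k) (hcov : ∀ h q, k (rotPair h q) = σ h (k q)) (h : SO 2) (r : E 2) :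
    eLpNorm (fun n => k (n, rot h r)) 2 sphereMeasure
      ≤ ‖σ h‖ₑ * eLpNorm (fun n => k (n, r)) 2 sphereMeasure := by
  have h1 : (fun n => k (n, rot h r))
      = fun n => σ h ((fun m => k (m, r)) (rotSphere (inclSO h)⁻¹ n)) := by
    funext n
    rw [← hcov]
    simp [rotPair, rotSphere_rotSphere_inv]
  have h0 : AEStronglyMeasurable (fun m => k (m, r)) sphereMeasure :=
    (hk.comp_measurable measurable_prodMk_right).aestronglyMeasurable
  have h2 := eLpNorm_comp_measurePreserving (p := 2) h0
    (measurePreserving_rotSphere (inclSO h)⁻¹)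
  rw [h1, ← h2]
  exact eLpNorm_le_nnreal_smul_eLpNorm_of_ae_le_mul (c := ‖σ h‖₊)
    (Eventually.of_forall fun n => (σ h).le_opNNNorm _) 2

/-- The averaged kernel can moreover be made square-integrable over the sphere at every point of
the plane, by setting it to zero on the null set where it is not, which is rotation-invariant. -/
theorem exists_covariant_memLp [CompleteSpace X] [NormedSpace ℝ X]
    (σ : SO 2 →* (X →L[𝕜] X)) (hσ : Continuous σ) {k₀ : S2 × E 2 → X} (hk₀ : StronglyMeasurable k₀)
    (hcov : ∀ h n, ∀ᵐ r, k₀ (rotPair h (n, r)) = σ h (k₀ (n, r)))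
    (hfin : ∀ᵐ r, eLpNorm (fun n => k₀ (n, r)) 2 sphereMeasure < ∞) :
    ∃ k : S2 × E 2 → X, StronglyMeasurable k ∧ (∀ h q, k (rotPair h q) = σ h (k q)) ∧
      (∀ n, ∀ᵐ r, k (n, r) = k₀ (n, r)) ∧
      ∀ r, MemLp (fun n => k (n, r)) 2 sphereMeasure := by
  obtain ⟨k₁, hk₁, hcov₁, hae⟩ := exists_covariant_of_ae_covariant σ hσ hk₀ hcov
  let M : Set (E 2) := {r | eLpNorm (fun n => k₁ (n, r)) 2 sphereMeasure < ∞}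
  have hM : MeasurableSet M := measurableSet_lt (measurable_eLpNorm_two hk₁) measurable_const
  have hrot : ∀ h r, r ∈ M → rot h r ∈ M := fun h r hr =>
    (eLpNorm_rotPair_le σ hk₁ hcov₁ h r).trans_lt (ENNReal.mul_lt_top enorm_lt_top hr)
  have hMae : ∀ᵐ r, r ∈ M := by
    have h1 := (ae_ae_eq_comm (μ := sphereMeasure) (ν := (volume : Measure (E 2))) hk₁ hk₀).1
      (Eventually.of_forall hae)
    filter_upwards [h1, hfin] with r h2 h3
    exact (eLpNorm_congr_ae h2).trans_lt h3
  refine ⟨(Prod.snd ⁻¹' M).indicator k₁, hk₁.indicator (measurable_snd hM), ?_, ?_, ?_⟩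
  · intro h q
    by_cases hq : q.2 ∈ M
    · rw [Set.indicator_of_mem (show rotPair h q ∈ Prod.snd ⁻¹' M from hrot h _ hq),
        Set.indicator_of_mem (show q ∈ Prod.snd ⁻¹' M from hq), hcov₁]
    · have hq' : rot h q.2 ∉ M := fun h' => hq (by simpa [rot_inv_rot] using hrot h⁻¹ _ h')
      rw [Set.indicator_of_notMem (show rotPair h q ∉ Prod.snd ⁻¹' M from hq'),
        Set.indicator_of_notMem (show q ∉ Prod.snd ⁻¹' M from hq), map_zero]
  · intro n
    filter_upwards [hae n, hMae] with r h1 h2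
    rw [Set.indicator_of_mem (show (n, r) ∈ Prod.snd ⁻¹' M from h2), h1]
  · intro r
    by_cases hr : r ∈ M
    · have h1 : (fun n => (Prod.snd ⁻¹' M).indicator k₁ (n, r)) = fun n => k₁ (n, r) :=
        funext fun n => Set.indicator_of_mem (show (n, r) ∈ Prod.snd ⁻¹' M from hr) k₁
      rw [h1]
      exact ⟨(hk₁.comp_measurable measurable_prodMk_right).aestronglyMeasurable, hr⟩
    · have h1 : (fun n => (Prod.snd ⁻¹' M).indicator k₁ (n, r)) = fun _ => 0 :=
        funext fun n => Set.indicator_of_notMem (show (n, r) ∉ Prod.snd ⁻¹' M from hr) k₁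
      rw [h1]
      exact MemLp.zero

end Averaging

/-! ### Bounded maps on square-integrable fields are integral maps -/

section Riesz

variable {𝕜 : Type*} [RCLike 𝕜]

/-- A bounded functional on `L²` is integration against a square-integrable function. -/
theorem exists_memLp_of_functional {α : Type*} [MeasurableSpace α] {μ : Measure α}
    (L : Lp 𝕜 2 μ →L[𝕜] 𝕜) : ∃ k : α → 𝕜, MemLp k 2 μ ∧ eLpNorm k 2 μ = ‖L‖ₑ ∧
      ∀ (g : α → 𝕜) (hg : MemLp g 2 μ),
        Integrable (fun a => k a * g a) μ ∧ L hg.toLp = ∫ a, k a * g a ∂μ := by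
  let u := (InnerProductSpace.toDual 𝕜 (Lp 𝕜 2 μ)).symm L
  have hu : ‖u‖ = ‖L‖ := LinearIsometryEquiv.norm_map _ _
  have hk : MemLp (fun a => conj (u a)) 2 μ :=
    (RCLike.conjCLE (K := 𝕜)).toContinuousLinearMap.comp_memLp' (Lp.memLp u)
  refine ⟨fun a => conj (u a), hk, ?_, fun g hg => ⟨hk.integrable_mul hg, ?_⟩⟩
  · have h1 : eLpNorm (fun a => conj (u a)) 2 μ = eLpNorm u 2 μ :=
      eLpNorm_congr_norm_ae (Eventually.of_forall fun a => RCLike.norm_conj _)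
    rw [h1, ← Lp.enorm_def, ← ofReal_norm, ← ofReal_norm, hu]
  · have h1 : inner 𝕜 u hg.toLp = L hg.toLp := InnerProductSpace.toDual_symm_apply
    rw [← h1, L2.inner_def]
    refine integral_congr_ae ?_
    filter_upwards [hg.coeFn_toLp] with a ha
    rw [ha, RCLike.inner_apply, mul_comm]

variable {V : Type*} [NormedAddCommGroup V] [NormedSpace 𝕜 V]
variable {V' : Type*} [NormedAddCommGroup V'] [NormedSpace 𝕜 V']

theorem memLp_smul_const {α : Type*} [MeasurableSpace α] {μ : Measure α} {g : α → 𝕜} {p : ℝ≥0∞}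
    (hg : MemLp g p μ) (v : V) : MemLp (fun a => g a • v) p μ :=
  (ContinuousLinearMap.toSpanSingleton 𝕜 v).comp_memLp' hg

theorem apply_eq_of_ae_eq {T : squareIntegrableFields 𝕜 V →ₗ[𝕜] V'} {C : ℝ}
    (hT : ∀ f, ‖T f‖ ≤ C * (eLpNorm f.1 2 volume).toReal) {f g : squareIntegrableFields 𝕜 V}
    (h : f.1 =ᵐ[volume] g.1) : T f = T g := by
  rw [← sub_eq_zero, ← map_sub, ← norm_le_zero_iff]
  refine (hT _).trans_eq ?_
  have h0 : eLpNorm (f - g).1 2 volume = 0 := by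
    rw [eLpNorm_congr_ae (g := 0) (by filter_upwards [h] with r hr; simp [hr]), eLpNorm_zero]
  rw [h0, ENNReal.toReal_zero, mul_zero]

/-- The functional `g ↦ c (T (g • v))` on `L²` obtained from a bounded map `T` on square-integrable
fields. -/
def coordFunctional (T : squareIntegrableFields 𝕜 V →ₗ[𝕜] V') (C : ℝ)
    (hT : ∀ f, ‖T f‖ ≤ C * (eLpNorm f.1 2 volume).toReal) (v : V) (c : V' →L[𝕜] 𝕜) :
    Lp 𝕜 2 (volume : Measure (E 2)) →L[𝕜] 𝕜 :=
  LinearMap.mkContinuous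
    { toFun := fun g => c (T ⟨fun r => g r • v, memLp_smul_const (Lp.memLp g) v⟩)
      map_add' := fun g g' => by
        rw [← map_add, ← map_add]
        refine congrArg c (apply_eq_of_ae_eq hT ?_)
        filter_upwards [Lp.coeFn_add g g'] with r hr
        change (g + g' : Lp 𝕜 2 volume) r • v = g r • v + g' r • v
        rw [hr, Pi.add_apply, add_smul]
      map_smul' := fun a g => by
        rw [RingHom.id_apply, ← map_smul, ← map_smul]
        refine congrArg c (apply_eq_of_ae_eq hT ?_)
        filter_upwards [Lp.coeFn_smul a g] with r hr
        change (a • g : Lp 𝕜 2 volume) r • v = a • g r • v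
        rw [hr, Pi.smul_apply, smul_assoc] }
    (‖c‖ * (|C| * ‖v‖)) (fun g => by
      have h1 : (eLpNorm (fun r => g r • v) 2 volume).toReal ≤ ‖v‖ * ‖g‖ := by
        have h2 : eLpNorm (fun r => g r • v) 2 volume ≤ ‖v‖ₑ * eLpNorm g 2 volume :=
          eLpNorm_le_nnreal_smul_eLpNorm_of_ae_le_mul (c := ‖v‖₊)
            (Eventually.of_forall fun r => by rw [nnnorm_smul, mul_comm]) 2
        refine (ENNReal.toReal_mono (ENNReal.mul_ne_top enorm_ne_top (Lp.eLpNorm_ne_top g))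
          h2).trans_eq ?_
        rw [ENNReal.toReal_mul, toReal_enorm, Lp.norm_def]
      calc ‖c (T ⟨fun r => g r • v, memLp_smul_const (Lp.memLp g) v⟩)‖
          ≤ ‖c‖ * ‖T ⟨fun r => g r • v, memLp_smul_const (Lp.memLp g) v⟩‖ := c.le_opNorm _
        _ ≤ ‖c‖ * (|C| * (‖v‖ * ‖g‖)) := by
            gcongr
            refine (hT _).trans ?_
            gcongr
            exact le_abs_self C
        _ = ‖c‖ * (|C| * ‖v‖) * ‖g‖ := by ring)

theorem coordFunctional_toLp (T : squareIntegrableFields 𝕜 V →ₗ[𝕜] V') (C : ℝ)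
    (hT : ∀ f, ‖T f‖ ≤ C * (eLpNorm f.1 2 volume).toReal) (v : V) (c : V' →L[𝕜] 𝕜) (g : E 2 → 𝕜)
    (hg : MemLp g 2 volume) :
    coordFunctional T C hT v c hg.toLp = c (T ⟨fun r => g r • v, memLp_smul_const hg v⟩) := by
  refine congrArg c (apply_eq_of_ae_eq hT ?_)
  filter_upwards [hg.coeFn_toLp] with r hr
  simp [hr]

theorem eLpNorm_sum_smul_le {α ι : Type*} [Fintype ι] [MeasurableSpace α] {μ : Measure α}
    {k : ι → α → 𝕜} (hk : ∀ i, AEStronglyMeasurable (k i) μ) (e : ι → V) :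
    eLpNorm (fun a => ∑ i, k i a • e i) 2 μ ≤ ∑ i, ‖e i‖ₑ * eLpNorm (k i) 2 μ := by
  have h1 : (fun a => ∑ i, k i a • e i) = ∑ i, fun a => k i a • e i := by
    funext a
    rw [Finset.sum_apply]
  rw [h1]
  refine (eLpNorm_sum_le (fun i _ => (hk i).smul_const (e i)) (by norm_num)).trans
    (Finset.sum_le_sum fun i _ => ?_)
  exact eLpNorm_le_nnreal_smul_eLpNorm_of_ae_le_mul (c := ‖e i‖₊)
    (Eventually.of_forall fun r => by rw [nnnorm_smul, mul_comm]) 2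

theorem enorm_coordFunctional_le (T : squareIntegrableFields 𝕜 V →ₗ[𝕜] V') (C : ℝ)
    (hT : ∀ f, ‖T f‖ ≤ C * (eLpNorm f.1 2 volume).toReal) (v : V) (c : V' →L[𝕜] 𝕜) :
    ‖coordFunctional T C hT v c‖ₑ ≤ ENNReal.ofReal (‖c‖ * (|C| * ‖v‖)) := by
  rw [← ofReal_norm]
  exact ENNReal.ofReal_le_ofReal (LinearMap.mkContinuous_norm_le _ (by positivity) _)

theorem apply_eq_sum_coordFunctional {ι ι' : Type*} [Fintype ι] [Fintype ι']
    (T : squareIntegrableFields 𝕜 V →ₗ[𝕜] V') (C : ℝ)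
    (hT : ∀ f, ‖T f‖ ≤ C * (eLpNorm f.1 2 volume).toReal) {b : ι → V} {b' : ι' → V'}
    {c : ι → V →L[𝕜] 𝕜} {c' : ι' → V' →L[𝕜] 𝕜} (hb : ∀ v, ∑ i, c i v • b i = v)
    (hb' : ∀ v, ∑ j, c' j v • b' j = v) (f : squareIntegrableFields 𝕜 V)
    (hf : ∀ i, MemLp (fun r => c i (f.1 r)) 2 volume) :
    T f = ∑ q : ι × ι', coordFunctional T C hT (b q.1) (c' q.2) (hf q.1).toLp • b' q.2 := by
  have h : f = ∑ i, (⟨fun r => c i (f.1 r) • b i, memLp_smul_const (hf i) (b i)⟩ :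
      squareIntegrableFields 𝕜 V) := by
    refine Subtype.ext (funext fun r => ?_)
    rw [Submodule.coe_sum, Finset.sum_apply]
    exact (hb (f.1 r)).symm
  conv_lhs => rw [h, map_sum]
  rw [Fintype.sum_prod_type]
  refine Finset.sum_congr rfl fun i _ => ?_
  rw [← hb' (T _)]
  exact Finset.sum_congr rfl fun j _ => by rw [coordFunctional_toLp]

/-- Riesz representation for maps between finite-dimensional fields, with a bound on the kernel
that depends only on the bound on the map. -/
theorem exists_kernel_of_bounded (V V' : Type*) [NormedAddCommGroup V] [NormedSpace 𝕜 V]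
    [NormedAddCommGroup V'] [NormedSpace 𝕜 V'] [FiniteDimensional 𝕜 V] [FiniteDimensional 𝕜 V']
    [NormedSpace ℝ V'] [IsScalarTower ℝ 𝕜 V'] (C : ℝ) : ∃ B : ℝ≥0∞, B < ∞ ∧
    ∀ T : squareIntegrableFields 𝕜 V →ₗ[𝕜] V',
      (∀ f, ‖T f‖ ≤ C * (eLpNorm f.1 2 volume).toReal) →
      ∃ K : E 2 → (V →L[𝕜] V'), MemLp K 2 volume ∧ eLpNorm K 2 volume ≤ B ∧
        ∀ f : squareIntegrableFields 𝕜 V, T f = ∫ r, K r (f.1 r) := by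
  have := FiniteDimensional.complete 𝕜 V'
  obtain ⟨m, b, c, hb⟩ : ∃ (m : ℕ) (b : Fin m → V) (c : Fin m → V →L[𝕜] 𝕜),
      ∀ v, ∑ i, c i v • b i = v :=
    ⟨_, Module.finBasis 𝕜 V, fun i => LinearMap.toContinuousLinearMap
      ((Module.finBasis 𝕜 V).coord i), (Module.finBasis 𝕜 V).sum_repr⟩
  obtain ⟨m', b', c', hb'⟩ : ∃ (m : ℕ) (b : Fin m → V') (c : Fin m → V' →L[𝕜] 𝕜),
      ∀ v, ∑ i, c i v • b i = v :=
    ⟨_, Module.finBasis 𝕜 V', fun i => LinearMap.toContinuousLinearMap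
      ((Module.finBasis 𝕜 V').coord i), (Module.finBasis 𝕜 V').sum_repr⟩
  let e : Fin m × Fin m' → V →L[𝕜] V' := fun q => (c q.1).smulRight (b' q.2)
  refine ⟨∑ q, ‖e q‖ₑ * ENNReal.ofReal (‖c' q.2‖ * (|C| * ‖b q.1‖)),
    ENNReal.sum_lt_top.2 fun q _ => ENNReal.mul_lt_top enorm_lt_top ENNReal.ofReal_lt_top,
    fun T hT => ?_⟩
  choose k hk hkn hkT using fun q : Fin m × Fin m' =>
    exists_memLp_of_functional (coordFunctional T C hT (b q.1) (c' q.2))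
  have hK : MemLp (fun r => ∑ q, k q r • e q) 2 volume :=
    memLp_finsetSum (f := fun q r => k q r • e q) Finset.univ
      fun q _ => memLp_smul_const (hk q) (e q)
  refine ⟨fun r => ∑ q, k q r • e q, hK, ?_, fun f => ?_⟩
  · refine (eLpNorm_sum_smul_le (fun q => (hk q).1) e).trans (Finset.sum_le_sum fun q _ => ?_)
    rw [hkn]
    gcongr
    exact enorm_coordFunctional_le T C hT _ _
  · have hf : ∀ i, MemLp (fun r => c i (f.1 r)) 2 volume := fun i => (c i).comp_memLp' f.2
    have hint : ∀ q, Integrable fun r => (k q r * c q.1 (f.1 r)) • b' q.2 := fun q =>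
      (hkT q _ (hf q.1)).1.smul_const (b' q.2)
    have h1 : ∀ r, (∑ q, k q r • e q) (f.1 r) = ∑ q, (k q r * c q.1 (f.1 r)) • b' q.2 := by
      intro r
      rw [sum_apply]
      exact Finset.sum_congr rfl fun q _ => smul_smul _ _ _
    simp only [h1]
    rw [integral_finsetSum _ fun q _ => hint q, apply_eq_sum_coordFunctional T C hT hb hb' f hf]
    refine Finset.sum_congr rfl fun q _ => ?_
    rw [(hkT q _ (hf q.1)).2, integral_smul_const]

end Riesz

section Mollification

variable {𝕜 : Type*} [RCLike 𝕜]
variable {V : Type*} [NormedAddCommGroup V] [NormedSpace 𝕜 V]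
variable {V' : Type*} [NormedAddCommGroup V'] [NormedSpace 𝕜 V']

theorem stronglyMeasurable_clm_of_apply [FiniteDimensional 𝕜 V] {α : Type*} [MeasurableSpace α] {k : α → (V →L[𝕜] V')}
    (h : ∀ v, StronglyMeasurable fun a => k a v) : StronglyMeasurable k := by
  let b := Module.finBasis 𝕜 V
  let c : Fin (Module.finrank 𝕜 V) → V →L[𝕜] 𝕜 := fun i =>
    LinearMap.toContinuousLinearMap (b.coord i)
  have hk : k = fun a => ∑ i, ContinuousLinearMap.smulRightL 𝕜 V V' (c i) (k a (b i)) := by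
    funext a
    ext v
    rw [sum_apply]
    conv_lhs => rw [← b.sum_repr v, map_sum]
    exact Finset.sum_congr rfl fun i _ => map_smul _ _ _
  rw [hk]
  exact Finset.stronglyMeasurable_fun_sum _ fun i _ =>
    (ContinuousLinearMap.continuous _).comp_stronglyMeasurable (h (b i))

/-- The standard mollifiers on the plane. -/
def planeBump (j : ℕ) : ContDiffBump (0 : E 2) where
  rIn := 1 / (j + 1)
  rOut := 2 / (j + 1)
  rIn_pos := by positivity
  rIn_lt_rOut := by gcongr; norm_num

theorem tendsto_planeBump_rOut : Tendsto (fun j => (planeBump j).rOut) atTop (𝓝 0) := by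
  have h := (tendsto_one_div_add_atTop_nhds_zero_nat (𝕜 := ℝ)).const_mul 2
  rw [mul_zero] at h
  refine h.congr fun j => ?_
  simp [planeBump, div_eq_mul_inv]

variable [NormedSpace ℝ V'] [IsScalarTower ℝ 𝕜 V']

/-- The mollification of an operator-valued function on the plane. -/
def mollify (j : ℕ) (K : E 2 → (V →L[𝕜] V')) (x : E 2) : V →L[𝕜] V' :=
  convolution ((planeBump j).normed volume) K (ContinuousLinearMap.lsmul ℝ ℝ) volume x

theorem continuous_mollify (j : ℕ) {K : E 2 → (V →L[𝕜] V')} (hK : LocallyIntegrable K) :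
    Continuous (mollify j K) :=
  HasCompactSupport.continuous_convolution_left _ (planeBump j).hasCompactSupport_normed
    (planeBump j).continuous_normed hK

theorem mollify_apply (j : ℕ) {K : E 2 → (V →L[𝕜] V')} (hK : LocallyIntegrable K) (x : E 2)
    (v : V) :
    mollify j K x v = ∫ r, K r ((((planeBump j).normed volume (x - r) : ℝ) : 𝕜) • v) := by
  have h1 : mollify j K x = ∫ r, (planeBump j).normed volume (x - r) • K r := by
    rw [mollify, convolution_eq_swap]
    rfl
  have hc : HasCompactSupport fun r => (planeBump j).normed volume (x - r) :=
    (planeBump j).hasCompactSupport_normed.comp_homeomorph (Homeomorph.subLeft x)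
  have h2 : Integrable fun r => (planeBump j).normed volume (x - r) • K r :=
    hK.integrable_smul_left_of_hasCompactSupport
      ((planeBump j).continuous_normed.comp (continuous_const.sub continuous_id)) hc
  rw [h1, ContinuousLinearMap.integral_apply h2]
  refine integral_congr_ae (Eventually.of_forall fun r => ?_)
  simp only [map_smul]
  rw [← RCLike.real_smul_eq_coe_smul (K := 𝕜)]
  rfl

theorem ae_tendsto_mollify [CompleteSpace V'] {K : E 2 → (V →L[𝕜] V')} (hK : LocallyIntegrable K) :
    ∀ᵐ x, Tendsto (fun j => mollify j K x) atTop (𝓝 (K x)) :=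
  ContDiffBump.ae_convolution_tendsto_right_of_locallyIntegrable (K := 2)
    tendsto_planeBump_rOut (Eventually.of_forall fun j => by
      simp [planeBump, div_eq_mul_inv]) hK

/-- A family of locally integrable kernels whose integrals against test fields depend measurably
on the parameter has a jointly measurable version: the pointwise limit of the mollifications, which
are continuous in the point and measurable in the parameter. -/
theorem exists_jointly_measurable [FiniteDimensional 𝕜 V] [CompleteSpace V'] {Ω : Type*}
    [MeasurableSpace Ω] {K : Ω → E 2 → (V →L[𝕜] V')}
    (hK : ∀ n, LocallyIntegrable (K n))
    (hm : ∀ f : E 2 → V, Continuous f → HasCompactSupport f →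
      StronglyMeasurable fun n => ∫ r, K n r (f r)) :
    ∃ k : Ω × E 2 → (V →L[𝕜] V'), StronglyMeasurable k ∧
      ∀ n, (fun r => k (n, r)) =ᵐ[volume] K n := by
  have h1 : ∀ j, StronglyMeasurable fun q : Ω × E 2 => mollify j (K q.1) q.2 := by
    intro j
    have h2 : ∀ x, StronglyMeasurable fun n => mollify j (K n) x := by
      intro x
      refine stronglyMeasurable_clm_of_apply fun v => ?_
      simp only [mollify_apply j (hK _)]
      refine hm _ ?_ ?_
      · exact (RCLike.continuous_ofReal.comp ((planeBump j).continuous_normed.comp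
          (continuous_const.sub continuous_id))).smul continuous_const
      · exact ((planeBump j).hasCompactSupport_normed.comp_homeomorph
          (Homeomorph.subLeft x)).comp_left (g := fun t : ℝ => (t : 𝕜) • v) (by simp)
    exact (stronglyMeasurable_uncurry_of_continuous_of_stronglyMeasurable
      (u := fun x n => mollify j (K n) x) (fun n => continuous_mollify j (hK n)) h2).comp_measurable
      measurable_swap
  refine ⟨fun q => limUnder atTop fun j => mollify j (K q.1) q.2,
    StronglyMeasurable.limUnder h1, fun n => ?_⟩
  filter_upwards [ae_tendsto_mollify (hK n)] with r hr
  exact hr.limUnder_eq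

/-- A map on square-integrable fields that is bounded in the supremum norm over the sphere, at each
point of space, is an integral map. -/
theorem isIntegralMap_of_bounded [FiniteDimensional 𝕜 V] [FiniteDimensional 𝕜 V']
    (Φ : squareIntegrableFields 𝕜 V →ₗ[𝕜] (E 3 × S2 → V'))
    (hm : ∀ f p, StronglyMeasurable fun n => Φ f (p, n))
    (hb : ∀ p, ∃ C : ℝ, ∀ f n, ‖Φ f (p, n)‖ ≤ C * (eLpNorm f.1 2 volume).toReal) :
    IsIntegralMap Φ := by
  have := FiniteDimensional.complete 𝕜 V'
  have hp : ∀ p : E 3, ∃ k : S2 × E 2 → (V →L[𝕜] V'), StronglyMeasurable k ∧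
      (∃ B : ℝ≥0∞, B < ∞ ∧ ∀ n, eLpNorm (fun r => k (n, r)) 2 volume ≤ B) ∧
      ∀ (f : squareIntegrableFields 𝕜 V) n, Φ f (p, n) = ∫ r, k (n, r) (f.1 r) := by
    intro p
    obtain ⟨C, hC⟩ := hb p
    obtain ⟨B, hB, hT⟩ := exists_kernel_of_bounded (𝕜 := 𝕜) V V' C
    choose K hK hKB hKΦ using fun n => hT ((LinearMap.proj (p, n)).comp Φ) fun f => hC f n
    obtain ⟨k, hk, hkK⟩ := exists_jointly_measurable (K := K)
      (fun n => (hK n).locallyIntegrable (by norm_num)) fun f hf hfs => by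
        simpa only [← hKΦ _ ⟨f, hf.memLp_of_hasCompactSupport hfs⟩] using! hm _ p
    refine ⟨k, hk, ⟨B, hB, fun n => (eLpNorm_congr_ae (hkK n)).trans_le (hKB n)⟩, fun f n => ?_⟩
    refine (hKΦ n f).trans (integral_congr_ae ?_)
    filter_upwards [hkK n] with r hr
    rw [← hr]
  choose k hk hB hΦ using hp
  refine ⟨fun q r => k q.1 (q.2, r), hk, fun p f hf => ?_, fun f p n => ⟨?_, hΦ p f n⟩⟩
  · obtain ⟨B, hB, hkB⟩ := hB p
    obtain ⟨f', hf', hff'⟩ := hf.1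
    have hN := measurable_eLpNorm_two (μ := sphereMeasure) (hk p)
    have he : ∫⁻ r, eLpNorm (fun n => k p (n, r)) 2 sphereMeasure * ‖f r‖ₑ
        = ∫⁻ r, eLpNorm (fun n => k p (n, r)) 2 sphereMeasure * ‖f' r‖ₑ := by
      refine lintegral_congr_ae ?_
      filter_upwards [hff'] with r hr
      rw [hr]
    refine lt_of_eq_of_lt he ((lintegral_mul_le_rpow_half hN hf'.enorm).trans_lt ?_)
    refine ENNReal.mul_lt_top ?_ ?_
    · refine ENNReal.rpow_lt_top_of_nonneg (by norm_num) (ne_of_lt ?_)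
      -- Tonelli: the squared norm is integrated over the plane first
      have h1 : ∀ r, eLpNorm (fun n => k p (n, r)) 2 sphereMeasure ^ (2 : ℝ)
          = ∫⁻ n, ‖k p (n, r)‖ₑ ^ (2 : ℝ) ∂sphereMeasure := fun r => by
        rw [eLpNorm_two_eq, ← ENNReal.rpow_mul]
        norm_num
      have h2 : ∀ n, ∫⁻ r, ‖k p (n, r)‖ₑ ^ (2 : ℝ) ≤ B ^ (2 : ℝ) := fun n => by
        refine le_of_eq_of_le ?_ (ENNReal.rpow_le_rpow (hkB n) (by norm_num))
        rw [eLpNorm_two_eq, ← ENNReal.rpow_mul]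
        norm_num
      simp only [h1]
      rw [lintegral_lintegral_swap (f := fun r n => ‖k p (n, r)‖ₑ ^ (2 : ℝ))
        (((hk p).enorm.pow_const _).comp measurable_swap).aemeasurable]
      refine (lintegral_mono h2).trans_lt ?_
      rw [lintegral_const]
      exact ENNReal.mul_lt_top (ENNReal.rpow_lt_top_of_nonneg (by norm_num) hB.ne)
        (measure_lt_top _ _)
    · rw [← eLpNorm_two_eq, ← eLpNorm_congr_ae hff']
      exact hf.2
  · obtain ⟨B, hB, hkB⟩ := hB p
    have h1 : MemLp (fun r => k p (n, r)) 2 volume :=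
      ⟨((hk p).comp_measurable measurable_prodMk_left).aestronglyMeasurable,
        (hkB n).trans_lt hB⟩
    refine (h1.norm.integrable_mul f.2.norm).mono' ?_
      (Eventually.of_forall fun r => (k p (n, r)).le_opNorm (f.1 r))
    exact (ContinuousLinearMap.apply 𝕜 V' : V →L[𝕜] (V →L[𝕜] V') →L[𝕜] V')
      |>.aestronglyMeasurable_comp₂ f.2.1 h1.1

end Mollification

/-! ### Rigid motions of the image plane -/

theorem rigid_inv_rigid {n : ℕ} (h : SE n) (r : E n) : rigid h⁻¹ (rigid h r) = r := by
  rw [← rigid_mul, inv_mul_cancel, rigid_one]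

theorem rigid_rigid_inv {n : ℕ} (h : SE n) (r : E n) : rigid h (rigid h⁻¹ r) = r := by
  rw [← rigid_mul, mul_inv_cancel, rigid_one]

theorem rigid_sub_rigid {n : ℕ} (h : SE n) (r s : E n) :
    rigid h r - rigid h s = rot h.right (r - s) := by
  simp [rigid]

theorem continuous_rigid {n : ℕ} (h : SE n) : Continuous (rigid h) :=
  (rot h.right).continuous.add continuous_const

theorem measurePreserving_rigid {n : ℕ} (h : SE n) : MeasurePreserving (rigid h) volume volume :=
  (measurePreserving_add_right volume h.left.toAdd).comp (measurePreserving_rot h.right)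

theorem integral_rigid {n : ℕ} {X : Type*} [NormedAddCommGroup X] [NormedSpace ℝ X] (h : SE n)
    (u : E n → X) : ∫ r, u (rigid h r) = ∫ r, u r := by
  have he : MeasurableEmbedding (rigid h) :=
    (Homeomorph.mk ⟨rigid h, rigid h⁻¹, rigid_inv_rigid h, rigid_rigid_inv h⟩
      (continuous_rigid h) (continuous_rigid h⁻¹)).measurableEmbedding
  exact (measurePreserving_rigid h).integral_comp he u

theorem integral_rigid_inv {n : ℕ} {X Z : Type*} [NormedAddCommGroup X] [NormedSpace ℝ X]
    (h : SE n) (u : E n → Z → X) (f : E n → Z) :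
    ∫ r, u r (f (rigid h⁻¹ r)) = ∫ r, u (rigid h r) (f r) := by
  rw [← integral_rigid h]
  simp only [rigid_inv_rigid]

theorem exists_eq_point (p : E 3) : ∃ (x : E 2) (z : ℝ), p = point x z :=
  ⟨!₂[p 0, p 1], p 2, by ext i; fin_cases i <;> simp [point]⟩

theorem right_inclSE (h : SE 2) : (inclSE h).right = inclSO h.right := rfl

section Representations

variable {𝕜 : Type*} [RCLike 𝕜]
variable {V : Type*} [NormedAddCommGroup V] [NormedSpace 𝕜 V]
variable {V' : Type*} [NormedAddCommGroup V'] [NormedSpace 𝕜 V']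

theorem rep_inv_apply_self {G : Type*} [Group G] (ρ : Representation 𝕜 G V) (g : G) (v : V) :
    ρ g⁻¹ (ρ g v) = v := by
  simp

theorem poseRep_inclSE_apply (ρ' : Representation 𝕜 (SO 3) V') (h : SE 2) (f : E 3 × S2 → V')
    (x : E 2) (z : ℝ) (n : S2) :
    (poseRep ρ').comp inclSE h f (point x z, n)
      = ρ' (inclSO h.right) (f (point (rigid h⁻¹ x) z, rotSphere (inclSO h.right)⁻¹ n)) := by
  change ρ' (inclSE h).right (f (rigid (inclSE h)⁻¹ (point x z), rotSphere (inclSE h).right⁻¹ n)) = _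
  rw [← map_inv, rigid_inclSE, right_inclSE]

variable [FiniteDimensional 𝕜 V] [FiniteDimensional 𝕜 V']

/-- The operators of a finite-dimensional representation, as continuous linear equivalences. -/
def repCLE {G : Type*} [Group G] (ρ : Representation 𝕜 G V) (g : G) : V ≃L[𝕜] V :=
  LinearEquiv.toContinuousLinearEquiv
    { (ρ g) with
      invFun := ρ g⁻¹
      left_inv := fun v => by simp
      right_inv := fun v => by simp }

theorem repCLE_apply {G : Type*} [Group G] (ρ : Representation 𝕜 G V) (g : G) (v : V) :
    repCLE ρ g v = ρ g v := rfl

/-- A representation on a finite-dimensional space by bounded operators. -/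
def repCLM {G : Type*} [Group G] (ρ : Representation 𝕜 G V) : G →* (V →L[𝕜] V) where
  toFun g := LinearMap.toContinuousLinearMap (ρ g)
  map_one' := by ext v; simp
  map_mul' g h := by ext v; simp

theorem repCLM_apply {G : Type*} [Group G] (ρ : Representation 𝕜 G V) (g : G) (v : V) :
    repCLM ρ g v = ρ g v := rfl

theorem continuous_repCLM {G : Type*} [Group G] [TopologicalSpace G] {ρ : Representation 𝕜 G V}
    (hρ : IsContinuousRep ρ) : Continuous (repCLM ρ) :=
  continuous_clm_apply.2 hρ

/-- The representation `A ↦ ρ↑(h) A ρ(h⁻¹)` of `SO(2)` on `Hom(V, V↑)`. -/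
def homRep (ρ : Representation 𝕜 (SO 2) V) (ρ' : Representation 𝕜 (SO 3) V') :
    SO 2 →* ((V →L[𝕜] V') →L[𝕜] (V →L[𝕜] V')) where
  toFun h := (ContinuousLinearMap.compL 𝕜 V V' V' (repCLM ρ' (inclSO h))).comp
    ((ContinuousLinearMap.compL 𝕜 V V V').flip (repCLM ρ h⁻¹))
  map_one' := by ext A v; simp
  map_mul' g h := by ext A v; simp

theorem homRep_apply (ρ : Representation 𝕜 (SO 2) V) (ρ' : Representation 𝕜 (SO 3) V')
    (h : SO 2) (A : V →L[𝕜] V') (v : V) : homRep ρ ρ' h A v = ρ' (inclSO h) (A (ρ h⁻¹ v)) := rfl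

theorem continuous_homRep {ρ : Representation 𝕜 (SO 2) V} (hρ : IsContinuousRep ρ)
    {ρ' : Representation 𝕜 (SO 3) V'} (hρ' : IsContinuousRep ρ') : Continuous (homRep ρ ρ') :=
  ((ContinuousLinearMap.continuous _).comp
    ((continuous_repCLM hρ').comp continuous_inclSO)).clm_comp
    ((ContinuousLinearMap.continuous _).comp ((continuous_repCLM hρ).comp continuous_inv))

end Representations

/-! ### Equivariance of convolutions and of harmonic expansions -/

section Sufficiency

theorem IsL2Series.ae_eq {X : Type*} [NormedAddCommGroup X] {g g' : S2 → X} {s : ℕ → S2 → X}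
    (h : IsL2Series g s) (h' : IsL2Series g' s) : g =ᵐ[sphereMeasure] g' := by
  have hs : ∀ N, AEStronglyMeasurable (fun n => ∑ ℓ ∈ Finset.range N, s ℓ n) sphereMeasure :=
    fun N => Finset.aestronglyMeasurable_fun_sum _ fun ℓ _ => (h.2.1 ℓ).1
  have hle : ∀ N, eLpNorm (g - g') 2 sphereMeasure
      ≤ eLpNorm (fun n => g n - ∑ ℓ ∈ Finset.range N, s ℓ n) 2 sphereMeasure
        + eLpNorm (fun n => g' n - ∑ ℓ ∈ Finset.range N, s ℓ n) 2 sphereMeasure := fun N => by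
    have h1 : g - g' = (fun n => g n - ∑ ℓ ∈ Finset.range N, s ℓ n)
        - fun n => g' n - ∑ ℓ ∈ Finset.range N, s ℓ n := by
      ext n; simp
    rw [h1]
    exact eLpNorm_sub_le (h.1.1.sub (hs N)) (h'.1.1.sub (hs N)) (by norm_num)
  have h0 : eLpNorm (g - g') 2 sphereMeasure ≤ 0 := by
    have := h.2.2.add h'.2.2
    rw [add_zero] at this
    exact ge_of_tendsto' this hle
  have h1 := (eLpNorm_eq_zero_iff (h.1.1.sub h'.1.1) (by norm_num)).1 (le_antisymm h0 zero_le)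
  filter_upwards [h1] with n hn
  exact sub_eq_zero.1 hn

variable {𝕜 : Type*} [RCLike 𝕜]
variable {V : Type*} [NormedAddCommGroup V] [NormedSpace 𝕜 V]
variable {V' : Type*} [NormedAddCommGroup V'] [NormedSpace 𝕜 V']

/-- An `L²(S²)`-convergent series may be rotated and transformed by a bounded operator. -/
theorem IsL2Series.comp_rotSphere {g : S2 → V'} {s : ℕ → S2 → V'} (h : IsL2Series g s)
    (L : V' →L[𝕜] V') (a : SO 3) :
    IsL2Series (fun n => L (g (rotSphere a n))) fun ℓ n => L (s ℓ (rotSphere a n)) := by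
  have hmp := measurePreserving_rotSphere a
  refine ⟨L.comp_memLp' (h.1.comp_measurePreserving hmp), fun ℓ =>
    L.comp_memLp' ((h.2.1 ℓ).comp_measurePreserving hmp), ?_⟩
  have hlim := ENNReal.Tendsto.const_mul (a := ‖L‖ₑ) h.2.2 (Or.inr enorm_ne_top)
  rw [mul_zero] at hlim
  refine tendsto_of_tendsto_of_tendsto_of_le_of_le tendsto_const_nhds hlim (fun _ => zero_le)
    fun N => ?_
  have h1 := eLpNorm_comp_measurePreserving (p := 2) (h.1.1.sub
    (Finset.aestronglyMeasurable_fun_sum (Finset.range N) fun ℓ _ => (h.2.1 ℓ).1)) hmp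
  change eLpNorm (fun n => L (g (rotSphere a n)) - ∑ ℓ ∈ Finset.range N, L (s ℓ (rotSphere a n))) 2
    sphereMeasure ≤ ‖L‖ₑ * eLpNorm (g - fun n => ∑ ℓ ∈ Finset.range N, s ℓ n) 2 sphereMeasure
  rw [← h1]
  refine eLpNorm_le_nnreal_smul_eLpNorm_of_ae_le_mul (c := ‖L‖₊)
    (Eventually.of_forall fun n => ?_) 2
  rw [← map_sum, ← map_sub]
  exact L.le_opNNNorm _

variable [FiniteDimensional 𝕜 V'] [NormedSpace ℝ V']
  {ρ : Representation 𝕜 (SO 2) V} {ρ' : Representation 𝕜 (SO 3) V'}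
  {𝓕 : Submodule 𝕜 (E 2 → V)} {Φ : 𝓕 →ₗ[𝕜] (E 3 × S2 → V')}

theorem isEquivariant_of_isPlanarConvolution [FiniteDimensional 𝕜 V] (h𝓕 : IsSignalSpace ρ 𝓕)
    {κ : ℝ → S2 → E 2 → (V →L[𝕜] V')} (hΦ : IsPlanarConvolution Φ κ)
    (hκ : ∀ z (h : SO 2) n r, κ z (rotSphere (inclSO h) n) (rot h r) = homRep ρ ρ' h (κ z n r)) :
    IsEquivariant ρ ρ' h𝓕 Φ := by
  intro h f
  funext q
  obtain ⟨p, n⟩ := q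
  obtain ⟨x, z, rfl⟩ := exists_eq_point p
  rw [poseRep_inclSE_apply, (hΦ _ x z n).2, (hΦ f _ z _).2, ← repCLE_apply,
    ← (repCLE ρ' (inclSO h.right)).integral_comp_comm]
  refine (integral_rigid_inv h (fun r v => κ z n (x - r) (ρ h.right v)) f.1).trans ?_
  refine integral_congr_ae (Eventually.of_forall fun r => ?_)
  have h1 : x - rigid h r = rot h.right (rigid h⁻¹ x - r) := by
    rw [← rigid_sub_rigid, rigid_rigid_inv]
  have h2 := hκ z h.right (rotSphere (inclSO h.right)⁻¹ n) (rigid h⁻¹ x - r)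
  rw [rotSphere_rotSphere_inv] at h2
  simp only [h1, h2, homRep_apply, rep_inv_apply_self, repCLE_apply]

/-- Equivariance of a harmonic expansion with steerable coefficients: both sides have the same
expansion, because the substitution `r ↦ h r` turns steerability of the coefficients into the
rotation of the output point and of the direction. -/
theorem ae_equivariant_of_hasHarmonicExpansion (h𝓕 : IsSignalSpace ρ 𝓕)
    {Y : ∀ ℓ, HarmonicBasis 𝕜 ℓ} {F : ∀ ℓ : ℕ, ℝ → E 2 → (V ⊗[𝕜] W 𝕜 ℓ →ₗ[𝕜] V')}
    (hF : ∀ ℓ z, IsSteerableKernel (ρ.tprod ((wignerD (Y ℓ)).comp inclSO)) (ρ'.comp inclSO) (F ℓ z))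
    (hΦ : HasHarmonicExpansion Φ Y F) (h : SE 2) (f : 𝓕) (p : E 3) :
    ∀ᵐ n ∂sphereMeasure, Φ ((planarRep ρ).subrepresentation 𝓕 h𝓕.stable h f) (p, n)
      = ((poseRep ρ').comp inclSE) h (Φ f) (p, n) := by
  obtain ⟨x, z, rfl⟩ := exists_eq_point p
  have h1 := (hΦ ((planarRep ρ).subrepresentation 𝓕 h𝓕.stable h f) x z).2
  have h2 := (hΦ f (rigid h⁻¹ x) z).2.comp_rotSphere (repCLM ρ' (inclSO h.right))
    (inclSO h.right)⁻¹
  simp only [poseRep_inclSE_apply]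
  refine IsL2Series.ae_eq h1 ((congrArg (IsL2Series _) ?_).mpr h2)
  funext ℓ n
  rw [repCLM_apply, ← repCLE_apply, ← (repCLE ρ' (inclSO h.right)).integral_comp_comm]
  refine (integral_rigid_inv h
    (fun r v => F ℓ z (x - r) (ρ h.right v ⊗ₜ[𝕜] harmonicVector (Y ℓ) n)) f.1).trans ?_
  refine integral_congr_ae (Eventually.of_forall fun r => ?_)
  have h3 : x - rigid h r = rot h.right (rigid h⁻¹ x - r) := by
    rw [← rigid_sub_rigid, rigid_rigid_inv]
  simp only [h3, hF ℓ z h.right (rigid h⁻¹ x - r), LinearMap.comp_apply, MonoidHom.comp_apply,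
    repCLE_apply, harmonicVector_rotSphere]
  simp [Representation.tprod_apply]

end Sufficiency

/-! ### The convolution kernel of an equivariant integral map -/

section Necessity

variable {𝕜 : Type*} [RCLike 𝕜]
variable {V : Type*} [NormedAddCommGroup V] [NormedSpace 𝕜 V]
variable {V' : Type*} [NormedAddCommGroup V'] [NormedSpace 𝕜 V']
  {ρ : Representation 𝕜 (SO 2) V} {ρ' : Representation 𝕜 (SO 3) V'}
  {𝓕 : Submodule 𝕜 (E 2 → V)}

theorem ae_eLpNorm_lt_top (h𝓕 : IsSignalSpace ρ 𝓕) {k : S2 × E 2 → (V →L[𝕜] V')}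
    (hk : StronglyMeasurable k)
    (hfin : ∀ f ∈ 𝓕, ∫⁻ r, eLpNorm (fun n => k (n, r)) 2 sphereMeasure * ‖f r‖ₑ < ∞) :
    ∀ᵐ r, eLpNorm (fun n => k (n, r)) 2 sphereMeasure < ∞ := by
  rcases subsingleton_or_nontrivial V with hV | hV
  · refine Eventually.of_forall fun r => ?_
    have h0 : (fun n => k (n, r)) = (0 : S2 → V →L[𝕜] V') := funext fun n => by
      ext v
      rw [Subsingleton.elim v 0, map_zero, map_zero]
    rw [h0]
    exact (MemLp.zero (ε := V →L[𝕜] V')).2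
  obtain ⟨v, hv⟩ := exists_ne (0 : V)
  choose φ hφ1 _ hφs _ using fun j : ℕ => exists_continuous_one_zero_of_isCompact
    (isCompact_closedBall (0 : E 2) j) isClosed_empty (Set.disjoint_empty _)
  have hc : ∀ j, Continuous fun r => ((φ j r : ℝ) : 𝕜) • v := fun j =>
    (RCLike.continuous_ofReal.comp (φ j).continuous).smul continuous_const
  have hall : ∀ᵐ r, ∀ j : ℕ,
      eLpNorm (fun n => k (n, r)) 2 sphereMeasure * ‖((φ j r : ℝ) : 𝕜) • v‖ₑ < ∞ := by
    refine ae_all_iff.2 fun j => ae_lt_top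
      ((measurable_eLpNorm_two hk).mul (hc j).enorm.measurable) (hfin _ ?_).ne
    exact h𝓕.testFields _ (hc j) ((hφs j).comp_left (g := fun t : ℝ => (t : 𝕜) • v) (by simp))
  filter_upwards [hall] with r hr
  obtain ⟨j, hj⟩ := exists_nat_ge ‖r‖
  have h1 : φ j r = 1 := hφ1 j (mem_closedBall_zero_iff.2 hj)
  have h2 := hr j
  rw [h1, RCLike.ofReal_one, one_smul] at h2
  exact ENNReal.lt_top_of_mul_ne_top_left h2.ne (by simpa using hv)

variable [FiniteDimensional 𝕜 V] [FiniteDimensional 𝕜 V'] [NormedSpace ℝ V'] [IsScalarTower ℝ 𝕜 V']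
  {Φ : 𝓕 →ₗ[𝕜] (E 3 × S2 → V')}

/-- The kernel of an equivariant integral map is covariant under `SE(2)`, up to null sets. -/
theorem ae_covariant_of_isEquivariant (h𝓕 : IsSignalSpace ρ 𝓕) (hΦ : IsEquivariant ρ ρ' h𝓕 Φ)
    {κ : E 3 × S2 → E 2 → (V →L[𝕜] V')}
    (hκ : ∀ (f : 𝓕) (p : E 3) (n : S2),
      Integrable (fun r => κ (p, n) r (f.1 r)) ∧ Φ f (p, n) = ∫ r, κ (p, n) r (f.1 r))
    (h : SE 2) (x : E 2) (z : ℝ) (n : S2) :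
    ∀ᵐ r, κ (point (rigid h x) z, rotSphere (inclSO h.right) n) (rigid h r)
      = homRep ρ ρ' h.right (κ (point x z, n) r) := by
  have := FiniteDimensional.complete 𝕜 V'
  let q : E 3 × S2 := (point (rigid h x) z, rotSphere (inclSO h.right) n)
  have hint : ∀ f : 𝓕, Integrable fun r => κ q (rigid h r) (ρ h.right (f.1 r)) := fun f => by
    have h1 := (hκ ((planarRep ρ).subrepresentation 𝓕 h𝓕.stable h f) q.1 q.2).1
    have h2 := (measurePreserving_rigid h).integrable_comp_of_integrable h1
    refine h2.congr (Eventually.of_forall fun r => ?_)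
    change κ q (rigid h r) (ρ h.right (f.1 (rigid h⁻¹ (rigid h r)))) = _
    rw [rigid_inv_rigid]
  have heq : ∀ f : 𝓕, ∫ r, κ q (rigid h r) (ρ h.right (f.1 r))
      = ∫ r, ρ' (inclSO h.right) (κ (point x z, n) r (f.1 r)) := fun f => by
    have h1 := congrFun (hΦ h f) q
    rw [poseRep_inclSE_apply, rigid_inv_rigid, rotSphere_inv_rotSphere, (hκ _ q.1 q.2).2,
      (hκ f _ _).2] at h1
    simp only [← repCLE_apply ρ'] at h1 ⊢
    rw [(repCLE ρ' (inclSO h.right)).integral_comp_comm, ← h1]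
    exact (integral_rigid_inv h (fun r v => κ q r (ρ h.right v)) f.1).symm
  have h1 := ae_eq_of_integral_testFields_eq
    (k := fun r => (κ q (rigid h r)).comp (repCLM ρ h.right))
    (k' := fun r => (repCLM ρ' (inclSO h.right)).comp (κ (point x z, n) r))
    (fun f hf hs => hint ⟨f, h𝓕.testFields f hf hs⟩)
    (fun f hf hs => (repCLM ρ' (inclSO h.right)).integrable_comp
      (hκ ⟨f, h𝓕.testFields f hf hs⟩ _ _).1)
    (fun f hf hs => heq ⟨f, h𝓕.testFields f hf hs⟩)
  filter_upwards [h1] with r hr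
  ext v
  have h2 := congrArg (fun A : V →L[𝕜] V' => A (ρ h.right⁻¹ v)) hr
  simpa [repCLM_apply, homRep_apply] using! h2

/-- An equivariant integral map is, at each depth, a convolution with a kernel that is exactly
covariant under in-plane rotations and square-integrable over the sphere at each point. -/
theorem exists_convolution_kernel (hρ : IsContinuousRep ρ) (hρ' : IsContinuousRep ρ')
    (h𝓕 : IsSignalSpace ρ 𝓕) (hΦ : IsEquivariant ρ ρ' h𝓕 Φ) (hI : IsIntegralMap Φ) :
    ∃ κ : ℝ → S2 → E 2 → (V →L[𝕜] V'),
      (∀ z, StronglyMeasurable fun q : S2 × E 2 => κ z q.1 q.2) ∧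
      IsPlanarConvolution Φ κ ∧
      (∀ z (h : SO 2) n r, κ z (rotSphere (inclSO h) n) (rot h r) = homRep ρ ρ' h (κ z n r)) ∧
      (∀ z r, MemLp (fun n => κ z n r) 2 sphereMeasure) ∧
      ∀ (f : 𝓕) (x : E 2) (z : ℝ),
        ∫⁻ r, eLpNorm (fun n => κ z n (x - r)) 2 sphereMeasure * ‖f.1 r‖ₑ < ∞ := by
  have := FiniteDimensional.complete 𝕜 V'
  obtain ⟨κ, hκm, hκfin, hκ⟩ := hI
  have hcov := ae_covariant_of_isEquivariant h𝓕 hΦ hκ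
  have hneg : Measure.QuasiMeasurePreserving (Neg.neg : E 2 → E 2) volume volume :=
    (Measure.measurePreserving_neg (volume : Measure (E 2))).quasiMeasurePreserving
  have hz : ∀ z : ℝ, ∃ k : S2 × E 2 → (V →L[𝕜] V'), StronglyMeasurable k ∧
      (∀ h q, k (rotPair h q) = homRep ρ ρ' h (k q)) ∧
      (∀ n, ∀ᵐ r, k (n, r) = κ (point 0 z, n) (-r)) ∧
      ∀ r, MemLp (fun n => k (n, r)) 2 sphereMeasure := by
    intro z
    refine exists_covariant_memLp (homRep ρ ρ') (continuous_homRep hρ hρ')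
      (k₀ := fun q => κ (point 0 z, q.1) (-q.2))
      ((hκm (point 0 z)).comp_measurable (g := fun q : S2 × E 2 => (q.1, -q.2)) (by fun_prop)) ?_ ?_
    · intro g n
      have h1 := hcov (SemidirectProduct.inr g) 0 z n
      simp only [rigid, SemidirectProduct.right_inr, SemidirectProduct.left_inr, toAdd_one,
        map_zero, add_zero] at h1
      have h2 : ∀ᵐ r, κ (point 0 z, rotSphere (inclSO g) n) (rot g (-r))
          = homRep ρ ρ' g (κ (point 0 z, n) (-r)) := hneg.ae h1
      filter_upwards [h2] with r hr
      rw [map_neg] at hr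
      exact hr
    · have h1 := ae_eLpNorm_lt_top h𝓕 (hκm (point 0 z)) (hκfin (point 0 z))
      exact hneg.ae h1
  choose k hkm hkcov hkae hkL2 using hz
  -- translation covariance identifies the kernel at `(x, z)` with the convolution kernel
  have hconv : ∀ (x : E 2) z n, ∀ᵐ r, k z (n, x - r) = κ (point x z, n) r := by
    intro x z n
    have h1 := hcov (SemidirectProduct.inl (Multiplicative.ofAdd x)) 0 z n
    simp only [rigid, SemidirectProduct.right_inl, SemidirectProduct.left_inl, toAdd_ofAdd,
      map_one, map_zero, zero_add, rotSphere_one, LinearIsometryEquiv.coe_one, id_eq,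
      one_apply_eq_self] at h1
    have h2 := (measurePreserving_sub_right volume x).quasiMeasurePreserving.ae h1
    have h3 := (Measure.measurePreserving_sub_left volume x).quasiMeasurePreserving.ae (hkae z n)
    filter_upwards [h2, h3] with r hr2 hr3
    rw [hr3, neg_sub, ← hr2, sub_add_cancel]
  refine ⟨fun z n r => k z (n, r), fun z => hkm z, fun f x z n => ?_, fun z h n r => hkcov z h (n, r),
    hkL2, fun f x z => ?_⟩
  · have h1 : (fun r => κ (point x z, n) r (f.1 r)) =ᵐ[volume] fun r => k z (n, x - r) (f.1 r) := by
      filter_upwards [hconv x z n] with r hr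
      rw [hr]
    exact ⟨(hκ f _ n).1.congr h1, (hκ f _ n).2.trans (integral_congr_ae h1)⟩
  · refine lt_of_eq_of_lt (lintegral_congr_ae ?_) (hκfin (point x z) f.1 f.2)
    have h1 := (ae_ae_eq_comm (μ := sphereMeasure) (ν := (volume : Measure (E 2)))
      ((hkm z).comp_measurable (g := fun q : S2 × E 2 => (q.1, x - q.2)) (by fun_prop))
      (hκm (point x z))).1 (Eventually.of_forall fun n => hconv x z n)
    filter_upwards [h1] with r hr
    congr 1
    exact eLpNorm_congr_ae hr

end Necessity

/-! ### Steerable coefficients -/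

section Coefficients

variable {𝕜 : Type*} [RCLike 𝕜]

/-- The matrix of `D^ℓ(g)` with respect to the basis `Y_ℓ^k`. -/
def wignerMatrix {ℓ : ℕ} (Y : HarmonicBasis 𝕜 ℓ) (g : SO 3) :
    Matrix (Fin (2 * ℓ + 1)) (Fin (2 * ℓ + 1)) 𝕜 :=
  LinearMap.toMatrix' (wignerD Y g)

theorem wignerD_apply {ℓ : ℕ} (Y : HarmonicBasis 𝕜 ℓ) (g : SO 3) (w : W 𝕜 ℓ)
    (k : Fin (2 * ℓ + 1)) : wignerD Y g w k = ∑ j, wignerMatrix Y g k j * w j := by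
  conv_lhs => rw [← Matrix.toLin'_toMatrix' (wignerD Y g)]
  rfl

theorem harmonic_rotSphere {ℓ : ℕ} (Y : HarmonicBasis 𝕜 ℓ) (g : SO 3) (n : S2)
    (k : Fin (2 * ℓ + 1)) : (Y k).1 (rotSphere g n) = ∑ j, wignerMatrix Y g k j * (Y j).1 n := by
  have h := congrFun (harmonicVector_rotSphere Y g n) k
  rw [wignerD_apply] at h
  exact h

theorem integrable_conj_mul {ℓ : ℕ} (Y : HarmonicBasis 𝕜 ℓ) (j k : Fin (2 * ℓ + 1)) :
    Integrable (fun n => conj ((Y j).1 n) * (Y k).1 n) sphereMeasure :=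
  ((RCLike.continuous_conj.comp (continuous_harmonicBasis Y j)).mul
    (continuous_harmonicBasis Y k)).integrable_sphere

theorem wignerMatrix_eq_integral {ℓ : ℕ} {Y : HarmonicBasis 𝕜 ℓ} (hY : IsOrthonormalBasis Y)
    (g : SO 3) (k j : Fin (2 * ℓ + 1)) :
    wignerMatrix Y g k j = ∫ n, conj ((Y j).1 n) * (Y k).1 (rotSphere g n) ∂sphereMeasure := by
  simp only [harmonic_rotSphere, Finset.mul_sum, mul_left_comm (conj _)]
  rw [integral_finsetSum _ fun i _ => (integrable_conj_mul Y j i).const_mul _]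
  simp only [integral_const_mul, hY j]
  simp

/-- The Wigner matrices of an orthonormal basis are unitary. -/
theorem conj_wignerMatrix {ℓ : ℕ} {Y : HarmonicBasis 𝕜 ℓ} (hY : IsOrthonormalBasis Y)
    (g : SO 3) (k j : Fin (2 * ℓ + 1)) :
    conj (wignerMatrix Y g k j) = wignerMatrix Y g⁻¹ j k := by
  rw [wignerMatrix_eq_integral hY, wignerMatrix_eq_integral hY, ← integral_conj]
  refine Eq.trans (integral_congr_ae (Eventually.of_forall fun n => ?_)) (integral_rotSphere g _)
  simp only [rotSphere_inv_rotSphere, map_mul, RCLike.conj_conj]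
  exact mul_comm _ _

variable {V : Type*} [NormedAddCommGroup V] [NormedSpace 𝕜 V]
variable {V' : Type*} [NormedAddCommGroup V'] [NormedSpace 𝕜 V']

/-- The element of `Hom(V ⊗ W^ℓ, V↑)` with components `C_k` in `Hom(V, V↑)`:
`v ⊗ w ↦ ∑_k w_k C_k v`. -/
def homOfComponents {ℓ : ℕ} (C : Fin (2 * ℓ + 1) → (V →L[𝕜] V')) : V ⊗[𝕜] W 𝕜 ℓ →ₗ[𝕜] V' :=
  TensorProduct.lift (LinearMap.mk₂ 𝕜 (fun v w => ∑ k, w k • C k v)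
    (fun v v' w => by simp only [map_add, smul_add, Finset.sum_add_distrib])
    (fun a v w => by simp only [map_smul, Finset.smul_sum, smul_comm a])
    (fun v w w' => by simp only [Pi.add_apply, add_smul, Finset.sum_add_distrib])
    (fun a v w => by simp only [Pi.smul_apply, smul_assoc, Finset.smul_sum]))

theorem homOfComponents_tmul {ℓ : ℕ} (C : Fin (2 * ℓ + 1) → (V →L[𝕜] V')) (v : V) (w : W 𝕜 ℓ) :
    homOfComponents C (v ⊗ₜ[𝕜] w) = ∑ k, w k • C k v := rfl

variable [NormedSpace ℝ V'] [IsScalarTower ℝ 𝕜 V']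

/-- The harmonic coefficient of degree `ℓ` of a `Hom(V, V↑)`-valued function on the sphere; its
components are the integrals of the function against the conjugates of the `Y_ℓ^k`. -/
def harmonicCoeff {ℓ : ℕ} (Y : HarmonicBasis 𝕜 ℓ) (g : S2 → (V →L[𝕜] V')) :
    V ⊗[𝕜] W 𝕜 ℓ →ₗ[𝕜] V' :=
  homOfComponents fun k => ∫ m, conj ((Y k).1 m) • g m ∂sphereMeasure

theorem contract_harmonicCoeff [FiniteDimensional 𝕜 V] {ℓ : ℕ} (Y : HarmonicBasis 𝕜 ℓ) (g : S2 → (V →L[𝕜] V')) (n : S2) :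
    contract (harmonicCoeff Y g) (harmonicVector Y n) = harmonicTerm Y g n := by
  ext v
  change ∑ k, (Y k).1 n • (∫ m, conj ((Y k).1 m) • g m ∂sphereMeasure) v = _
  rw [harmonicTerm, sum_apply]
  rfl

theorem harmonicCoeff_tmul {ℓ : ℕ} (Y : HarmonicBasis 𝕜 ℓ) {g : S2 → (V →L[𝕜] V')}
    (hg : MemLp g 2 sphereMeasure) (v : V) (w : W 𝕜 ℓ) :
    harmonicCoeff Y g (v ⊗ₜ[𝕜] w)
      = ∑ k, w k • ∫ m, conj ((Y k).1 m) • g m v ∂sphereMeasure := by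
  rw [harmonicCoeff, homOfComponents_tmul]
  refine Finset.sum_congr rfl fun k _ => ?_
  rw [ContinuousLinearMap.integral_apply (integrable_conj_smul Y k hg)]
  rfl

theorem stronglyMeasurable_harmonicCoeff {ℓ : ℕ} (Y : HarmonicBasis 𝕜 ℓ)
    {k : S2 × E 2 → (V →L[𝕜] V')} (hk : StronglyMeasurable k) (t : V ⊗[𝕜] W 𝕜 ℓ) :
    StronglyMeasurable fun r => harmonicCoeff Y (fun n => k (n, r)) t := by
  induction t using TensorProduct.induction_on with
  | zero => simpa using stronglyMeasurable_const
  | add s t hs ht =>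
    simp only [map_add]
    exact hs.add ht
  | tmul v w =>
    simp only [harmonicCoeff, homOfComponents_tmul]
    refine Finset.stronglyMeasurable_fun_sum _ fun i _ => StronglyMeasurable.const_smul ?_ _
    have hc : StronglyMeasurable fun q : S2 × E 2 => conj ((Y i).1 q.1) :=
      (RCLike.continuous_conj.comp ((continuous_harmonicBasis Y i).comp
        continuous_fst)).stronglyMeasurable
    exact (ContinuousLinearMap.apply 𝕜 V' v).continuous.comp_stronglyMeasurable
      (hc.smul hk).integral_prod_left'

/-- The harmonic coefficients of a covariant kernel are steerable: substitute `m ↦ h m` in the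
coefficient integral, and move the Wigner matrix to the argument `w` by unitarity. -/
theorem isSteerableKernel_harmonicCoeff [FiniteDimensional 𝕜 V] [FiniteDimensional 𝕜 V']
    {ρ : Representation 𝕜 (SO 2) V}
    {ρ' : Representation 𝕜 (SO 3) V'} {ℓ : ℕ} {Y : HarmonicBasis 𝕜 ℓ} (hY : IsOrthonormalBasis Y)
    {k : S2 → E 2 → (V →L[𝕜] V')}
    (hcov : ∀ (h : SO 2) n r, k (rotSphere (inclSO h) n) (rot h r) = homRep ρ ρ' h (k n r))
    (hL2 : ∀ r, MemLp (fun n => k n r) 2 sphereMeasure) :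
    IsSteerableKernel (ρ.tprod ((wignerD Y).comp inclSO)) (ρ'.comp inclSO)
      fun r => harmonicCoeff Y fun n => k n r := by
  intro h r
  refine TensorProduct.ext' fun v w => ?_
  have := FiniteDimensional.complete 𝕜 V'
  set C : Fin (2 * ℓ + 1) → V' :=
    fun j => ∫ m, conj ((Y j).1 m) • k m r (ρ h⁻¹ v) ∂sphereMeasure with hC
  have hint : ∀ j, Integrable (fun m => conj ((Y j).1 m) • k m r (ρ h⁻¹ v)) sphereMeasure :=
    fun j => (ContinuousLinearMap.apply 𝕜 V' (ρ h⁻¹ v)).integrable_comp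
      (integrable_conj_smul Y j (hL2 r))
  have h1 : ∀ i, ∫ m, conj ((Y i).1 m) • k m (rot h r) v ∂sphereMeasure
      = ρ' (inclSO h) (∑ j, wignerMatrix Y (inclSO h)⁻¹ j i • C j) := by
    intro i
    have e : ∀ m, conj ((Y i).1 (rotSphere (inclSO h) m)) •
        k (rotSphere (inclSO h) m) (rot h r) v = repCLE ρ' (inclSO h)
          (∑ j, wignerMatrix Y (inclSO h)⁻¹ j i • (conj ((Y j).1 m) • k m r (ρ h⁻¹ v))) := fun m => by
      rw [hcov, homRep_apply, harmonic_rotSphere, map_sum, Finset.sum_smul, map_sum]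
      refine Finset.sum_congr rfl fun j _ => ?_
      rw [map_mul, conj_wignerMatrix hY, repCLE_apply, map_smul, map_smul, smul_smul]
    rw [← integral_rotSphere (inclSO h)]
    simp only [e]
    rw [(repCLE ρ' (inclSO h)).integral_comp_comm, repCLE_apply,
      integral_finsetSum _ fun j _ => (hint j).fun_smul _]
    simp only [integral_smul, hC]
  have h2 : harmonicCoeff Y (fun n => k n r) (ρ h⁻¹ v ⊗ₜ[𝕜] wignerD Y (inclSO h)⁻¹ w)
      = ∑ j, (∑ i, wignerMatrix Y (inclSO h)⁻¹ j i * w i) • C j := by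
    rw [harmonicCoeff_tmul Y (hL2 r)]
    exact Finset.sum_congr rfl fun j _ => by rw [wignerD_apply]
  change harmonicCoeff Y (fun n => k n (rot h r)) (v ⊗ₜ[𝕜] w) = ρ' (inclSO h)
    (harmonicCoeff Y (fun n => k n r) (ρ h⁻¹ v ⊗ₜ[𝕜] wignerD Y (inclSO h⁻¹) w))
  rw [map_inv inclSO, h2, harmonicCoeff_tmul Y (hL2 _)]
  simp only [h1, ← map_smul (ρ' (inclSO h))]
  rw [← map_sum]
  congr 1
  simp only [Finset.smul_sum, Finset.sum_smul]
  rw [Finset.sum_comm]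
  exact Finset.sum_congr rfl fun j _ => Finset.sum_congr rfl fun i _ => by
    rw [smul_smul, mul_comm]

/-- The harmonic expansion of `n ↦ ∫ k(n, r) f(r) dr` is obtained from that of the kernel under the
integral sign. -/
theorem isL2Series_integral_kernel [FiniteDimensional 𝕜 V'] {Y : ∀ ℓ, HarmonicBasis 𝕜 ℓ}
    (hY : ∀ ℓ, IsOrthonormalBasis (Y ℓ)) {k : S2 × E 2 → (V →L[𝕜] V')} (hk : StronglyMeasurable k)
    (hL2 : ∀ r, MemLp (fun n => k (n, r)) 2 sphereMeasure) {f : E 2 → V}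
    (hf : AEStronglyMeasurable f volume)
    (hfin : ∫⁻ r, eLpNorm (fun n => k (n, r)) 2 sphereMeasure * ‖f r‖ₑ < ∞) :
    (∀ ℓ (w : W 𝕜 ℓ),
      Integrable fun r => harmonicCoeff (Y ℓ) (fun n => k (n, r)) (f r ⊗ₜ[𝕜] w)) ∧
    IsL2Series (fun n => ∫ r, k (n, r) (f r))
      fun ℓ n => ∫ r, harmonicCoeff (Y ℓ) (fun n => k (n, r)) (f r ⊗ₜ[𝕜] harmonicVector (Y ℓ) n) := by
  have := FiniteDimensional.complete 𝕜 V'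
  have hprod : ∀ ℓ i, Integrable (fun q : S2 × E 2 => conj ((Y ℓ i).1 q.1) • k q (f q.2))
      (sphereMeasure.prod volume) := fun ℓ i =>
    integrable_prod_smul_kernel hk hf hfin
      ((RCLike.continuous_conj.comp (continuous_harmonicBasis (Y ℓ) i)).memLp_of_hasCompactSupport
        (HasCompactSupport.of_compactSpace _))
  have hint : ∀ ℓ i, Integrable fun r =>
      ∫ m, conj ((Y ℓ i).1 m) • k (m, r) (f r) ∂sphereMeasure := fun ℓ i =>
    (hprod ℓ i).integral_prod_right
  have ht : ∀ ℓ r (w : W 𝕜 ℓ), harmonicCoeff (Y ℓ) (fun n => k (n, r)) (f r ⊗ₜ[𝕜] w)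
      = ∑ i, w i • ∫ m, conj ((Y ℓ i).1 m) • k (m, r) (f r) ∂sphereMeasure := fun ℓ r w =>
    harmonicCoeff_tmul (Y ℓ) (hL2 r) (f r) w
  simp only [ht]
  refine ⟨fun ℓ w => integrable_finsetSum _ fun i _ => (hint ℓ i).smul _, ?_⟩
  refine (congrArg (IsL2Series _) ?_).mpr
    (isL2Series_harmonicTerm hY (memLp_two_integral_kernel hk hf hfin))
  funext ℓ n
  rw [integral_finsetSum _ fun i _ => (hint ℓ i).fun_smul _]
  refine Finset.sum_congr rfl fun i _ => ?_
  rw [integral_smul, ← integral_integral_swap (hprod ℓ i)]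
  simp only [integral_smul]
  rfl

theorem hasHarmonicExpansion_of_isPlanarConvolution [FiniteDimensional 𝕜 V]
    [FiniteDimensional 𝕜 V'] {Y : ∀ ℓ, HarmonicBasis 𝕜 ℓ} (hY : ∀ ℓ, IsOrthonormalBasis (Y ℓ))
    {𝓕 : Submodule 𝕜 (E 2 → V)} (hm : ∀ f ∈ 𝓕, AEStronglyMeasurable f volume)
    {Φ : 𝓕 →ₗ[𝕜] (E 3 × S2 → V')} {κ : ℝ → S2 → E 2 → (V →L[𝕜] V')}
    (hκ : ∀ z, StronglyMeasurable fun q : S2 × E 2 => κ z q.1 q.2) (hΦ : IsPlanarConvolution Φ κ)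
    (hL2 : ∀ z r, MemLp (fun n => κ z n r) 2 sphereMeasure)
    (hfin : ∀ (f : 𝓕) (x : E 2) (z : ℝ),
      ∫⁻ r, eLpNorm (fun n => κ z n (x - r)) 2 sphereMeasure * ‖f.1 r‖ₑ < ∞) :
    HasHarmonicExpansion Φ Y fun ℓ z r => harmonicCoeff (Y ℓ) fun n => κ z n r := by
  intro f x z
  have hk : StronglyMeasurable fun q : S2 × E 2 => κ z q.1 (x - q.2) :=
    (hκ z).comp_measurable (g := fun q : S2 × E 2 => (q.1, x - q.2)) (by fun_prop)
  obtain ⟨h1, h2⟩ := isL2Series_integral_kernel (k := fun q => κ z q.1 (x - q.2)) hY hk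
    (fun r => hL2 z (x - r)) (hm f.1 f.2) (hfin f x z)
  have he : (fun n => Φ f (point x z, n)) = fun n => ∫ r, κ z n (x - r) (f.1 r) :=
    funext fun n => (hΦ f x z n).2
  rw [he]
  exact ⟨h1, h2⟩

end Coefficients

end PoseKernel

end

open PoseKernel in
theorem mainTheorem5 {𝕜 : Type*} [RCLike 𝕜]
    {V : Type*} [NormedAddCommGroup V] [NormedSpace 𝕜 V] [FiniteDimensional 𝕜 V]
    {V' : Type*} [NormedAddCommGroup V'] [NormedSpace 𝕜 V'] [FiniteDimensional 𝕜 V']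
    [NormedSpace ℝ V'] [IsScalarTower ℝ 𝕜 V']
    (ρ : Representation 𝕜 (SO 2) V) (hρ : IsContinuousRep ρ)
    (ρ' : Representation 𝕜 (SO 3) V') (hρ' : IsContinuousRep ρ')
    (Y : ∀ ℓ, HarmonicBasis 𝕜 ℓ) (hY : ∀ ℓ, IsOrthonormalBasis (Y ℓ)) :
    -- bounded linear maps on square-integrable fields are integral maps
    (∀ Φ : squareIntegrableFields 𝕜 V →ₗ[𝕜] (E 3 × S2 → V'),
      (∀ f p, StronglyMeasurable fun n => Φ f (p, n)) →
      (∀ p, ∃ C : ℝ, ∀ f n, ‖Φ f (p, n)‖ ≤ C * (eLpNorm f.1 2 volume).toReal) →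
      IsIntegralMap Φ) ∧
    ∀ (𝓕 : Submodule 𝕜 (E 2 → V)) (h𝓕 : IsSignalSpace ρ 𝓕) (Φ : 𝓕 →ₗ[𝕜] (E 3 × S2 → V')),
      -- the equivariant integral maps
      (IsIntegralMap Φ →
        (IsEquivariant ρ ρ' h𝓕 Φ ↔
          ∃ (κ : ℝ → S2 → E 2 → (V →L[𝕜] V'))
            (F : ∀ ℓ : ℕ, ℝ → E 2 → (V ⊗[𝕜] W 𝕜 ℓ →ₗ[𝕜] V')),
            (∀ z, StronglyMeasurable fun q : S2 × E 2 => κ z q.1 q.2) ∧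
            (∀ ℓ z t, StronglyMeasurable fun r => F ℓ z r t) ∧
            IsPlanarConvolution Φ κ ∧
            (∀ z (h : SO 2) n r, (κ z (rotSphere (inclSO h) n) (rot h r) : V →ₗ[𝕜] V')
              = ρ' (inclSO h) ∘ₗ (κ z n r : V →ₗ[𝕜] V') ∘ₗ ρ h⁻¹) ∧
            (∀ z r, IsL2Series (fun n => κ z n r)
              (fun ℓ n => contract (F ℓ z r) (harmonicVector (Y ℓ) n))) ∧
            (∀ ℓ z, IsSteerableKernel (ρ.tprod ((wignerD (Y ℓ)).comp inclSO)) (ρ'.comp inclSO)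
              (F ℓ z)) ∧
            HasHarmonicExpansion Φ Y F)) ∧
      -- every harmonic expansion with steerable coefficients is equivariant
      (∀ F : ∀ ℓ : ℕ, ℝ → E 2 → (V ⊗[𝕜] W 𝕜 ℓ →ₗ[𝕜] V'),
        (∀ ℓ z, IsSteerableKernel (ρ.tprod ((wignerD (Y ℓ)).comp inclSO)) (ρ'.comp inclSO)
          (F ℓ z)) →
        HasHarmonicExpansion Φ Y F →
        ∀ (h : SE 2) (f : 𝓕) (p : E 3), ∀ᵐ n ∂sphereMeasure,
          Φ ((planarRep ρ).subrepresentation 𝓕 h𝓕.stable h f) (p, n)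
            = ((poseRep ρ').comp inclSE) h (Φ f) (p, n)) := by
  refine ⟨isIntegralMap_of_bounded, fun 𝓕 h𝓕 Φ => ⟨fun hI => ⟨fun hΦ => ?_, ?_⟩, fun F hF hΦ =>
    ae_equivariant_of_hasHarmonicExpansion h𝓕 hF hΦ⟩⟩
  · obtain ⟨κ, hκm, hconv, hcov, hL2, hfin⟩ := exists_convolution_kernel hρ hρ' h𝓕 hΦ hI
    refine ⟨κ, fun ℓ z r => harmonicCoeff (Y ℓ) fun n => κ z n r, hκm,
      fun ℓ z t => stronglyMeasurable_harmonicCoeff (k := fun q => κ z q.1 q.2) (Y ℓ) (hκm z) t,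
      hconv, fun z h n r => ?_, fun z r => ?_,
      fun ℓ z => isSteerableKernel_harmonicCoeff (hY ℓ) (hcov z) (hL2 z),
      hasHarmonicExpansion_of_isPlanarConvolution hY h𝓕.measurable hκm hconv hL2 hfin⟩
    · rw [hcov]
      rfl
    · simp only [contract_harmonicCoeff]
      exact isL2Series_harmonicTerm hY (hL2 z r)
  · rintro ⟨κ, F, -, -, hconv, hcov, -⟩
    exact isEquivariant_of_isPlanarConvolution h𝓕 hconv fun z h n r =>
      ContinuousLinearMap.coe_injective (hcov z h n r)
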